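/- Let $K$ be a field of characteristic $0$, let $P$ be a prime ideal of codimension (height) $c$ in $R=K[x_1,\dots,x_n]$, and let $F=\mathrm{Quot}(R/P)$, with $u_j\in F$ the class of $x_j$. One can choose $c$ of the variables such that the remaining $n-c$ variables are independent modulo $P$ (no nonzero polynomial in them lies in $P$). Fix any such choice; after permuting the variables, the chosen ones are $x_1,\dots,x_c$, so that $K[x_{c+1},\dots,x_n]\cap P=0$. Notation. Let $\gamma:R\to F[y_1,\dots,y_c]\subset F[[y_1,\dots,y_c]]$ be the $K$-algebra map with $x_i\mapsto y_i+u_i$ for $i\le c$ and $x_j\mapsto u_j$ for $j>c$. Let $F[[y_1,\dots,y_c]]$ act on $F[z_1,\dots,z_c]$ by $y_i=\partial_{z_i}$; write $I^\perp=\{G: f\bullet G=0\text{ for all }f\in I\}$ and $\mathrm{Ann}(V)=\{f: f\bullet G=0\text{ for all }G\in V\}$. Let $D_{n,c}=K\langle x_1,\dots,x_n,\partial_{x_1},\dots,\partial_{x_c}\rangle$ be the relative Weyl algebra, i.e. the $K$-algebra on these $n+c$ generators, which commute except for $\partial_{x_i}x_i=x_i\partial_{x_i}+1$; it acts on $R$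 as differential operators, written $A\bullet f$. The Weyl–Noether module $F\otimes_R D_{n,c}$ is formed with the left $R$-module structure of $D_{n,c}$; it is a left $F$-vector space and a right $R$-module via $(a\otimes A)\cdot r=a\otimes Ar$. Let $\omega:F[z_1,\dots,z_c]\to F\otimes_R D_{n,c}$ be the $F$-linear map with $z^\alpha\mapsto 1\otimes\partial_{x_1}^{\alpha_1}\cdots\partial_{x_c}^{\alpha_c}$. For every integer $m\ge 1$, the following four sets are in bijection: (a) $P$-primary ideals $Q$ of $R$ of multiplicity $m$ over $P$, i.e. with $\mathrm{length}(R_P/QR_P)=m$; (b) points of the punctual Hilbert scheme $\mathrm{Hilb}^m(F[[y_1,\dots,y_c]])$, i.e. ideals $I$ of $F[[y_1,\dots,y_c]]$ of colength $m$; (c) $m$-dimensional $F$-subspaces $V$ of $F[z_1,\dots,z_c]$ that are closed under differentiation; (d) $m$-dimensional $F$-subspaces $E$ of $F\otimes_R D_{n,c}$ that are $R$-bimodules. Explicitly, the following maps are bijections with the stated inverses: from (a) to (b), $Q\mapsto\langle y_1,\dots,y_c\rangle^m+\langle\gamma(Q)\rangle$ with inverse $I\mapsto\gamma^{-1}(I)$;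 from (b) to (c), $I\mapsto I^\perp$ with inverse $V\mapsto\mathrm{Ann}(V)$; from (c) to (d), $V\mapsto\omega(V)$ with inverse $E\mapsto\omega^{-1}(E)$. Moreover, let $Q$ be as in (a) and let $E$ be the corresponding subspace in (d). Every $F$-basis $b_1,\dots,b_m$ of $E$ lifts, after clearing denominators, to $D_{n,c}$: there are $A_1,\dots,A_m\in D_{n,c}$ and $s_1,\dots,s_m\in R\setminus P$ with $1\otimes A_l=s_l b_l$ for all $l$. Any $A_1,\dots,A_m$ with this property are Noetherian operators that represent $Q$, that is, $Q=\{f\in R: A_l\bullet f\in P\text{ for }l=1,\dots,m\}$. -/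

import Mathlib

open scoped TensorProduct

noncomputable section

namespace PrimaryIdeals

variable {K : Type*} [Field K] {n c : ℕ}

/-- The field of fractions `F = Quot(R/P)` of the domain `R/P`, where `R = K[x_1, …, x_n]`. -/
abbrev ResField (P : Ideal (MvPolynomial (Fin n) K)) : Type _ :=
  FractionRing (MvPolynomial (Fin n) K ⧸ P)

/-- `e` selects the `c` variables `x_{e 1}, …, x_{e c}`; the condition says that the other variables
are independent modulo `P`, that is, `K[x_j : j ∉ range e] ∩ P = 0`.  If `P` has codimension `c`,
these `n - c` variables then form a maximal independent set modulo `P`. -/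
def ComplementIndependent (P : Ideal (MvPolynomial (Fin n) K)) (e : Fin c ↪ Fin n) : Prop :=
  ∀ f ∈ P, f ∈ MvPolynomial.supported K (Set.range e)ᶜ → f = 0

/-! ### Primary ideals of given multiplicity -/

/-- The multiplicity over `P` of an ideal `Q`: the length of `R_P / Q R_P`. -/
def multiplicity (P : Ideal (MvPolynomial (Fin n) K)) [P.IsPrime]
    (Q : Ideal (MvPolynomial (Fin n) K)) : ℕ∞ :=
  Module.length (Localization.AtPrime P)
    (Localization.AtPrime P ⧸
      Q.map (algebraMap (MvPolynomial (Fin n) K) (Localization.AtPrime P)))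

/-- The `P`-primary ideals of multiplicity `m` over `P`. -/
def primaryIdeals (P : Ideal (MvPolynomial (Fin n) K)) [P.IsPrime] (m : ℕ) :
    Set (Ideal (MvPolynomial (Fin n) K)) :=
  {Q | Q.IsPrimary ∧ Q.radical = P ∧ multiplicity P Q = m}

/-! ### The punctual Hilbert scheme -/

/-- The (classical) points of `Hilb^m(F[[y_1, …, y_c]])`: the ideals of colength `m`, for `m ≥ 1`
(`Module.finrank` is `0` for a quotient of infinite dimension). -/
def hilbPoints (F : Type*) [Field F] (c m : ℕ) : Set (Ideal (MvPowerSeries (Fin c) F)) :=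
  {I | Module.finrank F (MvPowerSeries (Fin c) F ⧸ I) = m}

/-- The `K`-algebra map `γ : R → F[y_1, …, y_c]` with `x_{e i} ↦ y_i + u_{e i}` for `1 ≤ i ≤ c` and
`x_j ↦ u_j` for the other variables, where `u_j` is the class of `x_j` in `F`. -/
def gamma (P : Ideal (MvPolynomial (Fin n) K)) [P.IsPrime] (e : Fin c ↪ Fin n) :
    MvPolynomial (Fin n) K →ₐ[K] MvPolynomial (Fin c) (ResField P) :=
  MvPolynomial.aeval fun j =>
    MvPolynomial.C (algebraMap (MvPolynomial (Fin n) K) (ResField P) (MvPolynomial.X j)) +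
      ∑ i, if e i = j then MvPolynomial.X i else 0

/-- `γ` followed by the inclusion `F[y_1, …, y_c] ⊆ F[[y_1, …, y_c]]`. -/
def gammaHat (P : Ideal (MvPolynomial (Fin n) K)) [P.IsPrime] (e : Fin c ↪ Fin n) :
    MvPolynomial (Fin n) K →+* MvPowerSeries (Fin c) (ResField P) :=
  MvPolynomial.coeToMvPowerSeries.ringHom.comp (gamma P e).toRingHom

/-- `Q ↦ ⟨y_1, …, y_c⟩^m + ⟨γ(Q)⟩`. -/
def toHilb (P : Ideal (MvPolynomial (Fin n) K)) [P.IsPrime] (e : Fin c ↪ Fin n) (m : ℕ)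
    (Q : Ideal (MvPolynomial (Fin n) K)) : Ideal (MvPowerSeries (Fin c) (ResField P)) :=
  Ideal.span (Set.range MvPowerSeries.X) ^ m + Q.map (gammaHat P e)

/-! ### Macaulay's inverse systems -/

section InverseSystem

variable {F : Type*} [Field F]

/-- The integer `w(β, α)` with `∂^α z^β = w(β, α) z^(β - α)` for `α ≤ β`. -/
def derivWeight (β α : Fin c →₀ ℕ) : ℕ := ∏ i, (β i).descFactorial (α i)

/-- The action `f • G` of a power series `f = ∑ f_α ∂_z^α` (with `y_i = ∂_{z_i}`) on polynomials
`G ∈ F[z_1, …, z_c]`, given on the monomial basis by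
`f • z^β = ∑_{α ≤ β} f_α w(β, α) z^(β - α) = ∑_α f_α ∂_z^α z^β`. -/
def diffAct (f : MvPowerSeries (Fin c) F) : MvPolynomial (Fin c) F →ₗ[F] MvPolynomial (Fin c) F :=
  (MvPolynomial.basisMonomials (Fin c) F).constr F fun β =>
    ∑ α ∈ Finset.Iic β,
      MvPolynomial.monomial (β - α) (MvPowerSeries.coeff α f * (derivWeight β α : F))

theorem diffAct_monomial (f : MvPowerSeries (Fin c) F) (β : Fin c →₀ ℕ) :
    diffAct f (MvPolynomial.monomial β 1) = ∑ α ∈ Finset.Iic β,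
      MvPolynomial.monomial (β - α) (MvPowerSeries.coeff α f * (derivWeight β α : F)) := by
  unfold diffAct
  have h := (MvPolynomial.basisMonomials (Fin c) F).constr_basis F (fun β =>
    ∑ α ∈ Finset.Iic β,
      MvPolynomial.monomial (β - α) (MvPowerSeries.coeff α f * (derivWeight β α : F))) β
  rwa [MvPolynomial.coe_basisMonomials] at h

/-- Two linear maps on polynomials agree if they agree on monomials. -/
theorem linearMap_ext {A B : MvPolynomial (Fin c) F →ₗ[F] MvPolynomial (Fin c) F}
    (h : ∀ β, A (MvPolynomial.monomial β 1) = B (MvPolynomial.monomial β 1)) : A = B := by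
  refine (MvPolynomial.basisMonomials (Fin c) F).ext fun β => ?_
  rw [MvPolynomial.coe_basisMonomials]
  exact h β

/-- `y_i` acts as `∂_{z_i}`. -/
theorem diffAct_X (i : Fin c) :
    diffAct (MvPowerSeries.X i : MvPowerSeries (Fin c) F) =
      (MvPolynomial.pderiv i).toLinearMap := by
  classical
  refine linearMap_ext fun β => ?_
  rw [diffAct_monomial]
  change _ = MvPolynomial.pderiv i (MvPolynomial.monomial β 1)
  rw [MvPolynomial.pderiv_monomial, one_mul, Finset.sum_eq_single (Finsupp.single i 1)]
  · rw [MvPowerSeries.coeff_X, if_pos rfl, one_mul, derivWeight, Finset.prod_eq_single i]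
    · simp
    · intro j _ hj
      simp [Finsupp.single_eq_of_ne hj]
    · simp
  · intro α _ hα
    rw [MvPowerSeries.coeff_X, if_neg hα, zero_mul, map_zero]
  · intro h
    have h0 : β i = 0 := by
      by_contra h0
      refine h (Finset.mem_Iic.2 ?_)
      rw [Finsupp.single_le_iff]
      omega
    rw [derivWeight, Finset.prod_eq_zero (Finset.mem_univ i)] <;> simp [h0]

theorem diffAct_add (f g : MvPowerSeries (Fin c) F) :
    diffAct (f + g) = diffAct f + diffAct g := by
  refine linearMap_ext fun β => ?_
  rw [LinearMap.add_apply]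
  simp only [diffAct_monomial, map_add, add_mul, Finset.sum_add_distrib]

theorem derivWeight_add (α α' β : Fin c →₀ ℕ) :
    derivWeight β (α + α') = derivWeight β α' * derivWeight (β - α') α := by
  simp only [derivWeight, ← Finset.prod_mul_distrib, Finsupp.add_apply, Finsupp.tsub_apply]
  refine Finset.prod_congr rfl fun i _ => ?_
  rw [mul_comm, ← Nat.descFactorial_mul_descFactorial (Nat.le_add_left (α' i) (α i)),
    Nat.add_sub_cancel]

theorem diffAct_mul (f g : MvPowerSeries (Fin c) F) :
    diffAct (f * g) = diffAct f ∘ₗ diffAct g := by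
  classical
  refine linearMap_ext fun β => ?_
  rw [LinearMap.comp_apply, diffAct_monomial, diffAct_monomial, map_sum]
  have h1 : ∀ α : Fin c →₀ ℕ, diffAct f (MvPolynomial.monomial (β - α)
      (MvPowerSeries.coeff α g * (derivWeight β α : F))) =
      ∑ α' ∈ Finset.Iic (β - α), MvPolynomial.monomial (β - (α' + α))
        (MvPowerSeries.coeff α' f * MvPowerSeries.coeff α g *
          (derivWeight β (α' + α) : F)) := by
    intro α
    rw [← mul_one (_ * _ : F), ← smul_eq_mul, ← MvPolynomial.smul_monomial, map_smul,
      diffAct_monomial, Finset.smul_sum]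
    refine Finset.sum_congr rfl fun α' _ => ?_
    rw [MvPolynomial.smul_monomial, derivWeight_add, tsub_tsub, add_comm α α', smul_eq_mul]
    push_cast
    ring_nf
  simp only [h1, MvPowerSeries.coeff_mul, Finset.sum_mul, map_sum]
  rw [Finset.sum_sigma', Finset.sum_sigma']
  refine Finset.sum_bij' (fun p _ => ⟨p.2.2, p.2.1⟩)
    (fun p _ => ⟨p.2 + p.1, (p.2, p.1)⟩) ?_ ?_ ?_ ?_ ?_
  · rintro ⟨α, a, b⟩ h
    simp only [Finset.mem_sigma, Finset.mem_Iic, Finset.HasAntidiagonal.mem_antidiagonal] at h ⊢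
    obtain ⟨h, rfl⟩ := h
    exact ⟨le_trans le_add_self h, le_tsub_of_add_le_right h⟩
  · rintro ⟨b, a⟩ h
    simp only [Finset.mem_sigma, Finset.mem_Iic, Finset.HasAntidiagonal.mem_antidiagonal, and_true] at h ⊢
    exact (le_tsub_iff_right h.1).1 h.2
  · rintro ⟨α, a, b⟩ h
    simp only [Finset.mem_sigma, Finset.mem_Iic, Finset.HasAntidiagonal.mem_antidiagonal] at h
    obtain ⟨h, rfl⟩ := h
    rfl
  · rintro ⟨b, a⟩ h
    rfl
  · rintro ⟨α, a, b⟩ h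
    simp only [Finset.mem_sigma, Finset.mem_Iic, Finset.HasAntidiagonal.mem_antidiagonal] at h
    obtain ⟨h, rfl⟩ := h
    rfl

/-- The inverse system `I^⊥` of an ideal: the solution space `{G : f • G = 0 for all f ∈ I}`. -/
def inverseSystem (I : Ideal (MvPowerSeries (Fin c) F)) : Submodule F (MvPolynomial (Fin c) F) :=
  ⨅ f ∈ I, LinearMap.ker (diffAct f)

/-- The annihilator in `F[[∂_{z_1}, …, ∂_{z_c}]]` of a subspace of `F[z_1, …, z_c]`. -/
def annihilator (V : Submodule F (MvPolynomial (Fin c) F)) : Ideal (MvPowerSeries (Fin c) F) where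
  carrier := {f | ∀ G ∈ V, diffAct f G = 0}
  add_mem' := fun {f g} hf hg G hG => by
    rw [diffAct_add, LinearMap.add_apply, hf G hG, hg G hG, add_zero]
  zero_mem' := fun G _ => by
    have h := diffAct_add (0 : MvPowerSeries (Fin c) F) 0
    rw [add_zero, left_eq_add] at h
    rw [h, LinearMap.zero_apply]
  smul_mem' := fun f g hg G hG => by
    rw [smul_eq_mul, diffAct_mul, LinearMap.comp_apply, hg G hG, map_zero]

/-- The `m`-dimensional subspaces of `F[z_1, …, z_c]` closed under differentiation, for `m ≥ 1`. -/
def diffClosedSubspaces (F : Type*) [Field F] (c m : ℕ) :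
    Set (Submodule F (MvPolynomial (Fin c) F)) :=
  {V | Module.finrank F V = m ∧ ∀ i, ∀ G ∈ V, MvPolynomial.pderiv i G ∈ V}

end InverseSystem

/-! ### The relative Weyl algebra -/

/-- The defining relations of the relative Weyl algebra on the generators `x_1, …, x_n` (left
summand) and `∂_1, …, ∂_c` (right summand), where `∂_i` is the derivation in direction `x_{e i}`. -/
inductive WeylRel (K : Type*) [Field K] {n c : ℕ} (e : Fin c ↪ Fin n) :
    FreeAlgebra K (Fin n ⊕ Fin c) → FreeAlgebra K (Fin n ⊕ Fin c) → Prop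
  | x_comm (i j : Fin n) : WeylRel K e
      (FreeAlgebra.ι K (Sum.inl i) * FreeAlgebra.ι K (Sum.inl j))
      (FreeAlgebra.ι K (Sum.inl j) * FreeAlgebra.ι K (Sum.inl i))
  | d_comm (i j : Fin c) : WeylRel K e
      (FreeAlgebra.ι K (Sum.inr i) * FreeAlgebra.ι K (Sum.inr j))
      (FreeAlgebra.ι K (Sum.inr j) * FreeAlgebra.ι K (Sum.inr i))
  | d_x_comm (i : Fin c) (j : Fin n) (h : e i ≠ j) : WeylRel K e
      (FreeAlgebra.ι K (Sum.inr i) * FreeAlgebra.ι K (Sum.inl j))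
      (FreeAlgebra.ι K (Sum.inl j) * FreeAlgebra.ι K (Sum.inr i))
  | d_x_self (i : Fin c) : WeylRel K e
      (FreeAlgebra.ι K (Sum.inr i) * FreeAlgebra.ι K (Sum.inl (e i)))
      (FreeAlgebra.ι K (Sum.inl (e i)) * FreeAlgebra.ι K (Sum.inr i) + 1)

/-- The relative Weyl algebra `D_{n,c} = K⟨x_1, …, x_n, ∂_{x_{e 1}}, …, ∂_{x_{e c}}⟩`. -/
def RelWeyl (K : Type*) [Field K] {n c : ℕ} (e : Fin c ↪ Fin n) : Type _ :=
  RingQuot (WeylRel K e)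

namespace RelWeyl

instance (e : Fin c ↪ Fin n) : Ring (RelWeyl K e) :=
  inferInstanceAs (Ring (RingQuot (WeylRel K e)))

instance (e : Fin c ↪ Fin n) : Algebra K (RelWeyl K e) :=
  inferInstanceAs (Algebra K (RingQuot (WeylRel K e)))

/-- The generator `x_j`. -/
def x (e : Fin c ↪ Fin n) (j : Fin n) : RelWeyl K e :=
  RingQuot.mkAlgHom K (WeylRel K e) (FreeAlgebra.ι K (Sum.inl j))

/-- The generator `∂_i`, that is, `∂_{x_{e i}}`. -/
def d (e : Fin c ↪ Fin n) (i : Fin c) : RelWeyl K e :=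
  RingQuot.mkAlgHom K (WeylRel K e) (FreeAlgebra.ι K (Sum.inr i))

/-- The monomial `∂^α = ∂_1^{α_1} ⋯ ∂_c^{α_c}`. -/
def dPow (e : Fin c ↪ Fin n) (α : Fin c →₀ ℕ) : RelWeyl K e :=
  (List.ofFn fun i => d e i ^ α i).prod

theorem x_mul_x (e : Fin c ↪ Fin n) (i j : Fin n) :
    (x e i * x e j : RelWeyl K e) = x e j * x e i := by
  have h := RingQuot.mkAlgHom_rel K (WeylRel.x_comm (K := K) (e := e) i j)
  rw [map_mul, map_mul] at h
  exact h

open scoped IsMulCommutative in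
/-- The `K`-algebra map `R = K[x_1, …, x_n] → D_{n,c}` sending the variable `x_j` to the generator
`x_j`; see `ofPoly_X`. -/
def ofPoly (e : Fin c ↪ Fin n) : MvPolynomial (Fin n) K →ₐ[K] RelWeyl K e :=
  haveI : IsMulCommutative (Algebra.adjoin K (Set.range (x (K := K) e))) :=
    Algebra.isMulCommutative_adjoin K (by
      rintro _ ⟨i, rfl⟩ _ ⟨j, rfl⟩
      exact x_mul_x e i j)
  (Algebra.adjoin K (Set.range (x (K := K) e))).val.comp
    (MvPolynomial.aeval fun j => ⟨x e j, Algebra.subset_adjoin ⟨j, rfl⟩⟩)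

theorem ofPoly_X (e : Fin c ↪ Fin n) (j : Fin n) :
    ofPoly e (MvPolynomial.X j) = (x e j : RelWeyl K e) := by
  simp [ofPoly]

/-- The left `R`-module structure of `D_{n,c}`. -/
instance (e : Fin c ↪ Fin n) : Module (MvPolynomial (Fin n) K) (RelWeyl K e) :=
  Module.compHom (RelWeyl K e) (ofPoly e).toRingHom

theorem smul_def (e : Fin c ↪ Fin n) (r : MvPolynomial (Fin n) K) (a : RelWeyl K e) :
    r • a = ofPoly e r * a := rfl

/-- Right multiplication by `r ∈ R` on `D_{n,c}`. -/
def rightMul (e : Fin c ↪ Fin n) (r : MvPolynomial (Fin n) K) :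
    RelWeyl K e →ₗ[MvPolynomial (Fin n) K] RelWeyl K e where
  toFun a := a * ofPoly e r
  map_add' a b := add_mul a b _
  map_smul' s a := by simp only [smul_def, mul_assoc, RingHom.id_apply]

theorem pderiv_comm (i j : Fin n) (f : MvPolynomial (Fin n) K) :
    MvPolynomial.pderiv i (MvPolynomial.pderiv j f) =
      MvPolynomial.pderiv j (MvPolynomial.pderiv i f) := by
  let D (i : Fin n) : Derivation K (MvPolynomial (Fin n) K) (MvPolynomial (Fin n) K) :=
    MvPolynomial.pderiv i
  have h : ⁅D i, D j⁆ = 0 := by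
    classical
    refine MvPolynomial.derivation_ext fun k => ?_
    simp only [D, Derivation.commutator_apply, MvPolynomial.pderiv_X,
      Pi.single_apply]
    split_ifs <;> simp
  have h2 := DFunLike.congr_fun h f
  rwa [Derivation.commutator_apply, Derivation.zero_apply, sub_eq_zero] at h2

/-- The operators on `R` by which the generators act: multiplication by `x_j` and the partial
derivative with respect to `x_{e i}`. -/
def actGen (e : Fin c ↪ Fin n) : Fin n ⊕ Fin c → Module.End K (MvPolynomial (Fin n) K) :=
  Sum.elim (fun j => LinearMap.mulLeft K (MvPolynomial.X j))
    (fun i => (MvPolynomial.pderiv (e i)).toLinearMap)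

theorem actGen_rel (e : Fin c ↪ Fin n) ⦃a b : FreeAlgebra K (Fin n ⊕ Fin c)⦄
    (h : WeylRel K e a b) :
    FreeAlgebra.lift K (actGen (K := K) e) a = FreeAlgebra.lift K (actGen (K := K) e) b := by
  induction h with
  | x_comm i j =>
    refine LinearMap.ext fun f => ?_
    simp only [actGen, map_mul, FreeAlgebra.lift_ι_apply, Sum.elim_inl, Module.End.mul_apply,
      LinearMap.mulLeft_apply]
    ring
  | d_comm i j =>
    refine LinearMap.ext fun f => ?_
    simp only [actGen, map_mul, FreeAlgebra.lift_ι_apply, Sum.elim_inr, Module.End.mul_apply]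
    exact pderiv_comm (e i) (e j) f
  | d_x_comm i j h =>
    refine LinearMap.ext fun f => ?_
    simp only [actGen, map_mul, FreeAlgebra.lift_ι_apply, Sum.elim_inl, Sum.elim_inr,
      Module.End.mul_apply, LinearMap.mulLeft_apply, Derivation.coeFn_coe, Derivation.leibniz,
      smul_eq_mul,
      MvPolynomial.pderiv_X_of_ne h.symm, mul_zero, add_zero]
  | d_x_self i =>
    refine LinearMap.ext fun f => ?_
    simp only [actGen, map_mul, map_add, map_one, FreeAlgebra.lift_ι_apply, Sum.elim_inl,
      Sum.elim_inr, Module.End.mul_apply, LinearMap.mulLeft_apply, Derivation.coeFn_coe,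
      Derivation.leibniz, smul_eq_mul, MvPolynomial.pderiv_X_self,
      mul_one, LinearMap.add_apply, Module.End.one_apply]

/-- The natural action `A • f` of `D_{n,c}` on `R`; see `act_x` and `act_d`. -/
def act (e : Fin c ↪ Fin n) : RelWeyl K e →ₐ[K] Module.End K (MvPolynomial (Fin n) K) :=
  RingQuot.liftAlgHom K ⟨FreeAlgebra.lift K (actGen (K := K) e), actGen_rel e⟩

theorem act_x (e : Fin c ↪ Fin n) (j : Fin n) (f : MvPolynomial (Fin n) K) :
    act e (x e j) f = MvPolynomial.X j * f := by
  have h := RingQuot.liftAlgHom_mkAlgHom_apply K (FreeAlgebra.lift K (actGen (K := K) e)) (actGen_rel e)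
    (FreeAlgebra.ι K (Sum.inl j))
  rw [FreeAlgebra.lift_ι_apply] at h
  exact congrArg (fun T : Module.End K (MvPolynomial (Fin n) K) => T f) h

theorem act_d (e : Fin c ↪ Fin n) (i : Fin c) (f : MvPolynomial (Fin n) K) :
    act e (d e i) f = MvPolynomial.pderiv (e i) f := by
  have h := RingQuot.liftAlgHom_mkAlgHom_apply K (FreeAlgebra.lift K (actGen (K := K) e)) (actGen_rel e)
    (FreeAlgebra.ι K (Sum.inr i))
  rw [FreeAlgebra.lift_ι_apply] at h
  exact congrArg (fun T : Module.End K (MvPolynomial (Fin n) K) => T f) h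

end RelWeyl

/-! ### The Weyl-Noether module -/

/-- The Weyl-Noether module `F ⊗_R D_{n,c}`, formed with the left `R`-module structure of
`D_{n,c}`. -/
abbrev WeylNoether (P : Ideal (MvPolynomial (Fin n) K)) [P.IsPrime] (e : Fin c ↪ Fin n) : Type _ :=
  ResField P ⊗[MvPolynomial (Fin n) K] RelWeyl K e

/-- The right action of `r ∈ R`: `(a ⊗ A) · r = a ⊗ A r`. -/
def rightAct (P : Ideal (MvPolynomial (Fin n) K)) [P.IsPrime] (e : Fin c ↪ Fin n)
    (r : MvPolynomial (Fin n) K) : WeylNoether P e →ₗ[ResField P] WeylNoether P e :=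
  (RelWeyl.rightMul e r).baseChange (ResField P)

/-- The `m`-dimensional `F`-subspaces of the Weyl-Noether module that are `R`-bimodules, for
`m ≥ 1`. -/
def subBimodules (P : Ideal (MvPolynomial (Fin n) K)) [P.IsPrime] (e : Fin c ↪ Fin n) (m : ℕ) :
    Set (Submodule (ResField P) (WeylNoether P e)) :=
  {E | Module.finrank (ResField P) E = m ∧
    ∀ r : MvPolynomial (Fin n) K, ∀ w ∈ E, r • w ∈ E ∧ rightAct P e r w ∈ E}

/-- The `F`-linear map `ω : F[z_1, …, z_c] → F ⊗_R D_{n,c}` with `z^α ↦ 1 ⊗ ∂^α`. -/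
def omega (P : Ideal (MvPolynomial (Fin n) K)) [P.IsPrime] (e : Fin c ↪ Fin n) :
    MvPolynomial (Fin c) (ResField P) →ₗ[ResField P] WeylNoether P e :=
  (MvPolynomial.basisMonomials (Fin c) (ResField P)).constr (ResField P) fun α =>
    (1 : ResField P) ⊗ₜ[MvPolynomial (Fin n) K] RelWeyl.dPow e α

/-- The operators `A_1, …, A_m ∈ D_{n,c}` lift `w_1, …, w_m ∈ F ⊗_R D_{n,c}` after clearing
denominators: `1 ⊗ A_l = s_l w_l` with `s_l ∈ R \ P`. -/
def IsLift (P : Ideal (MvPolynomial (Fin n) K)) [P.IsPrime] (e : Fin c ↪ Fin n) {m : ℕ}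
    (w : Fin m → WeylNoether P e) (A : Fin m → RelWeyl K e) : Prop :=
  ∀ l, ∃ s : MvPolynomial (Fin n) K, s ∉ P ∧
    (1 : ResField P) ⊗ₜ[MvPolynomial (Fin n) K] A l = s • w l

/-- `A_1, …, A_m` are Noetherian operators representing `Q`:
`Q = {f ∈ R : A_l • f ∈ P for l = 1, …, m}`. -/
def Represents (P : Ideal (MvPolynomial (Fin n) K)) (e : Fin c ↪ Fin n) {m : ℕ}
    (A : Fin m → RelWeyl K e) (Q : Ideal (MvPolynomial (Fin n) K)) : Prop :=
  (Q : Set (MvPolynomial (Fin n) K)) = {f | ∀ l, RelWeyl.act e (A l) f ∈ P}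

end PrimaryIdeals

end

/-!
Three independent mechanisms carry the four-fold bijection.

*Ideals of colength `m` and inverse systems.* The pairing `⟨f, G⟩ = (f • G)(0)` of `F[[y]]` with
`F[z]` is diagonal on monomials with entries `α!`, so in characteristic `0` it identifies
`F[z]` with the space of functionals on `F[[y]]` that vanish on a power of the maximal ideal
(`exists_macaulayPairing_eq`). Multiplication on `F[[y]]` is adjoint to the action on `F[z]`
(`macaulayPairing_mul`), so inverse systems and annihilators are orthogonal complements, and an
ideal of colength `m` contains the `m`-th power of the maximal ideal. Linear duality then gives
`macaulay_correspondence`.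

*Inverse systems and bimodules.* The Leibniz rule shows that the `∂^α` generate `D_{n,c}` over `R`,
so `ω` is surjective. By Taylor's formula the operator `ω(G)` sends `f ∈ R` to `⟨γ(f), G⟩ ∈ F`
(`evalOp_omega`). As `γ(R)` spans `F[y]` over `F`, this makes `ω` an isomorphism, and the
Weyl-Noether module acts faithfully on `R`, which turns right multiplication by `r` into the action
of `γ(r)` on `F[z]` (`rightAct_omega`). Bimodules therefore correspond to subspaces closed under
differentiation. The same formula shows that lifts of a basis of `ω(I^⊥)` represent
`γ⁻¹(Ann(I^⊥)) = γ⁻¹(I)` (`represents_of_isLift`).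

*Primary ideals and ideals of colength `m`.* If `P` has height `c`, then `n - c` variables that are
independent modulo `P` form a transcendence basis of `F` over `K`: after inverting the nonzero
polynomials in a transcendence basis among the variables, `P` becomes a maximal ideal of a
polynomial ring over a field, whose height is the number of the other variables
(`height_eq_of_isTranscendenceBasis`). With `B` the polynomial ring in the independent variables,
`F` is separable over `Frac B`, hence formally étale over `B`, and the residue map `R_P / Q R_P → F`
has nilpotent kernel for `Q` primary to `P`. So there is a unique lift `σ : F → R_P / Q R_P` over
`B`. It extends to a surjection `F[[y]] → R_P / Q R_P` with `y_i ↦ x_i - σ(u_i)` through which `R →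
R_P / Q R_P` factors as the composite with `γ` (`exists_surjective_localQuot`). This identifies `R_P
/ Q R_P` with `F[[y]]/(⟨y⟩^m + ⟨γ(Q)⟩)`, and with `F[[y]]/I` for `Q = γ⁻¹(I)`. Length and
`F`-dimension agree because `F` is a coefficient field.
-/

noncomputable section

namespace PrimaryIdeals

/-! ### Length over a local ring -/

/-- A module of length at most `k` over a local ring is killed by the `k`-th power of the maximal
ideal. -/
theorem maximalIdeal_pow_smul_eq_zero {S : Type*} [CommRing S] [IsLocalRing S]
    {M : Type*} [AddCommGroup M] [Module S M] (h : IsFiniteLength S M) :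
    ∀ {k : ℕ}, Module.length S M ≤ k →
      ∀ s ∈ IsLocalRing.maximalIdeal S ^ k, ∀ v : M, s • v = 0 := by
  induction h with
  | of_subsingleton => exact fun _ _ _ _ => Subsingleton.elim _ _
  | @of_simple_quotient M _ _ N hs hN ih =>
    intro k hk s hs' v
    have hl := Module.length_eq_add_of_exact N.subtype N.mkQ N.subtype_injective
      N.mkQ_surjective (LinearMap.exact_subtype_mkQ N)
    rw [Module.length_eq_one S (M ⧸ N)] at hl
    obtain _ | k := k
    · rw [hl] at hk
      simp at hk
    have hk' : Module.length S N ≤ k := by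
      rw [hl, Nat.cast_add, Nat.cast_one] at hk
      exact (ENat.add_le_add_iff_right ENat.one_ne_top).1 hk
    rw [pow_succ] at hs'
    induction hs' using Submodule.mul_induction_on' with
    | add a _ b _ ha hb => rw [add_smul, ha, hb, add_zero]
    | mem_mul_mem a ha b hb =>
      have hbv : b • v ∈ N := by
        obtain ⟨I, hI, ⟨f⟩⟩ := isSimpleModule_iff_quot_maximal.1 hs
        rw [IsLocalRing.eq_maximalIdeal hI] at f
        rw [← Submodule.Quotient.mk_eq_zero, Submodule.Quotient.mk_smul,
          ← f.map_eq_zero_iff, map_smul]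
        obtain ⟨t, ht⟩ := Submodule.Quotient.mk_surjective _ (f (Submodule.Quotient.mk v))
        rw [← ht, ← Submodule.Quotient.mk_smul, Submodule.Quotient.mk_eq_zero]
        exact Ideal.mul_mem_right _ _ hb
      have := ih hk' a ha ⟨b • v, hbv⟩
      rw [mul_smul]
      simpa [Subtype.ext_iff] using this

/-- Over a local ring with coefficient field `F`, the length of a module is its dimension over `F`:
the simple module, the residue field, is one-dimensional. -/
theorem length_eq_length_field {F S : Type*} [Field F] [CommRing S] [IsLocalRing S] [Algebra F S]
    (hF : ∀ s : S, ∃ a : F, s - algebraMap F S a ∈ IsLocalRing.maximalIdeal S)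
    {M : Type*} [AddCommGroup M] [Module S M] (h : IsFiniteLength S M) :
    ∀ [Module F M] [IsScalarTower F S M], Module.length F M = Module.length S M := by
  induction h with
  | of_subsingleton => simp
  | @of_simple_quotient M _ _ N hs hN ih =>
    intro _ _
    rw [Module.length_eq_add_of_exact N.subtype N.mkQ N.subtype_injective
      N.mkQ_surjective (LinearMap.exact_subtype_mkQ N), Module.length_eq_one S (M ⧸ N),
      Module.length_eq_add_of_exact (N.subtype.restrictScalars F) (N.mkQ.restrictScalars F)
      N.subtype_injective N.mkQ_surjective (LinearMap.exact_subtype_mkQ N), ih]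
    congr 1
    obtain ⟨I, hI, ⟨f⟩⟩ := isSimpleModule_iff_quot_maximal.1 hs
    rw [IsLocalRing.eq_maximalIdeal hI] at f
    rw [(f.restrictScalars F).length_eq]
    have hb : Function.Bijective
        (Algebra.linearMap F (S ⧸ IsLocalRing.maximalIdeal S)) := by
      refine ⟨(algebraMap F _).injective, fun s => ?_⟩
      obtain ⟨s, rfl⟩ := Ideal.Quotient.mk_surjective s
      obtain ⟨a, ha⟩ := hF s
      exact ⟨a, (Ideal.Quotient.eq.2 ha).symm⟩
    rw [← (LinearEquiv.ofBijective _ hb).length_eq, Module.length_eq_one]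

/-- As `Module.finrank` vanishes in infinite dimension, `1 ≤ m` cannot be dropped. -/
theorem finrank_eq_iff_length_eq {F S : Type*} [Field F] [CommRing S] [IsLocalRing S] [Algebra F S]
    (hF : ∀ s : S, ∃ a : F, s - algebraMap F S a ∈ IsLocalRing.maximalIdeal S)
    {M : Type*} [AddCommGroup M] [Module S M] [Module F M] [IsScalarTower F S M]
    {m : ℕ} (hm : 1 ≤ m) :
    Module.finrank F M = m ↔ Module.length S M = m := by
  constructor
  · intro h
    have : Module.Finite F M := Module.finite_of_finrank_pos (by omega)
    have h1 : Module.length F M = m := by rw [Module.length_eq_finrank, h]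
    have h2 : Module.length S M ≤ Module.length F M := by
      rw [← WithBot.coe_le_coe, Module.coe_length, Module.coe_length]
      exact Order.krullDim_le_of_orderEmbedding (Submodule.restrictScalarsEmbedding F S M)
    rw [← h1, length_eq_length_field hF]
    refine Module.length_ne_top_iff.1 (ne_top_of_le_ne_top ?_ h2)
    rw [h1]
    exact ENat.natCast_ne_top m
  · intro h
    have h1 : Module.length F M = m := by
      rw [← h]
      refine length_eq_length_field hF (Module.length_ne_top_iff.1 ?_)
      rw [h]
      exact ENat.natCast_ne_top m
    rw [Module.length_eq_rank] at h1
    rw [Module.finrank, Cardinal.toNat, MonoidWithZeroHom.comp_apply]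
    simp [h1]

/-! ### Powers of the maximal ideal of the power series ring -/

section PowerSeries

variable {F : Type*} [Field F] {c : ℕ}

/-- A power series without terms of degree less than `N` lies in `⟨y_1, …, y_c⟩^N`. -/
theorem mem_span_X_pow (N : ℕ) (f : MvPowerSeries (Fin c) F)
    (hf : ∀ α : Fin c →₀ ℕ, α.degree < N → MvPowerSeries.coeff α f = 0) :
    f ∈ Ideal.span (Set.range (MvPowerSeries.X : Fin c → MvPowerSeries (Fin c) F)) ^ N := by
  classical
  induction N generalizing f with
  | zero => simp
  | succ N ih =>
    -- choose a variable dividing each nonconstant monomial, and collect the monomials by it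
    have hex : ∀ α : Fin c →₀ ℕ, α ≠ 0 → ∃ i, α i ≠ 0 := fun α h => by
      by_contra! h'
      exact h (Finsupp.ext h')
    let ι : (Fin c →₀ ℕ) → Option (Fin c) := fun α =>
      if h : α ≠ 0 then some (hex α h).choose else none
    have hι : ∀ α i, ι α = some i → α i ≠ 0 := by
      intro α i h
      by_cases h0 : α ≠ 0
      · simp only [ι, dif_pos h0, Option.some.injEq] at h
        exact h ▸ (hex α h0).choose_spec
      · simp [ι, h0] at h
    let g : Fin c → MvPowerSeries (Fin c) F := fun i δ =>
      if ι (δ + Finsupp.single i 1) = some i then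
        MvPowerSeries.coeff (δ + Finsupp.single i 1) f else 0
    have hg : ∀ i δ, MvPowerSeries.coeff δ (g i) =
      if ι (δ + Finsupp.single i 1) = some i then
        MvPowerSeries.coeff (δ + Finsupp.single i 1) f else 0 := fun i δ => rfl
    have hsum : f = ∑ i, MvPowerSeries.X i * g i := by
      ext α
      rw [map_sum]
      have hterm : ∀ i, MvPowerSeries.coeff α (MvPowerSeries.X i * g i) =
          if ι α = some i then MvPowerSeries.coeff α f else 0 := by
        intro i
        rw [MvPowerSeries.X, MvPowerSeries.coeff_monomial_mul, one_mul]
        by_cases hi : Finsupp.single i 1 ≤ α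
        · rw [if_pos hi, hg, tsub_add_cancel_of_le hi]
        · rw [if_neg hi, if_neg]
          intro h
          refine hi (Finsupp.single_le_iff.2 ?_)
          have := hι α i h
          omega
      simp only [hterm]
      by_cases h0 : α ≠ 0
      · have : ι α = some (hex α h0).choose := by simp only [ι, dif_pos h0]
        simp [this]
      · rw [not_not] at h0
        rw [hf α (by simp [h0])]
        simp
    rw [hsum, pow_succ']
    refine Ideal.sum_mem _ fun i _ => Ideal.mul_mem_mul (Ideal.subset_span ⟨i, rfl⟩) (ih _ ?_)
    intro δ hδ
    rw [hg]
    split_ifs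
    · refine hf _ ?_
      rw [map_add, Finsupp.degree_single]
      omega
    · rfl

theorem sub_truncTotal_mem (N : ℕ) (f : MvPowerSeries (Fin c) F) :
    f - (f.truncTotal N : MvPowerSeries (Fin c) F) ∈
      Ideal.span (Set.range (MvPowerSeries.X : Fin c → MvPowerSeries (Fin c) F)) ^ N := by
  refine mem_span_X_pow N _ fun α hα => ?_
  rw [map_sub, MvPolynomial.coeff_coe, MvPowerSeries.coeff_truncTotal _ hα, sub_self]

theorem mem_maximalIdeal_iff (f : MvPowerSeries (Fin c) F) :
    f ∈ IsLocalRing.maximalIdeal (MvPowerSeries (Fin c) F) ↔ MvPowerSeries.constantCoeff f = 0 := by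
  rw [IsLocalRing.mem_maximalIdeal, mem_nonunits_iff, MvPowerSeries.isUnit_iff_constantCoeff,
    isUnit_iff_ne_zero, not_not]

theorem span_X_eq_maximalIdeal :
    Ideal.span (Set.range (MvPowerSeries.X : Fin c → MvPowerSeries (Fin c) F)) =
      IsLocalRing.maximalIdeal (MvPowerSeries (Fin c) F) := by
  refine le_antisymm (Ideal.span_le.2 ?_) fun f hf => ?_
  · rintro _ ⟨i, rfl⟩
    exact (mem_maximalIdeal_iff _).2 (MvPowerSeries.constantCoeff_X i)
  · rw [← pow_one (Ideal.span _)]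
    refine mem_span_X_pow 1 f fun α hα => ?_
    rw [Nat.lt_one_iff, Finsupp.degree_eq_zero_iff] at hα
    rw [hα]
    exact (mem_maximalIdeal_iff f).1 hf

/-- `F` is a coefficient field of `F[[y]]`. -/
theorem residue_surjective (f : MvPowerSeries (Fin c) F) :
    ∃ a : F, f - algebraMap F _ a ∈ IsLocalRing.maximalIdeal (MvPowerSeries (Fin c) F) :=
  ⟨MvPowerSeries.constantCoeff f, (mem_maximalIdeal_iff _).2 (by
    simp [MvPowerSeries.algebraMap_apply])⟩

/-- An ideal of finite colength `m` contains the `m`-th power of the maximal ideal. -/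
theorem span_X_pow_le_of_finrank {I : Ideal (MvPowerSeries (Fin c) F)} {m : ℕ} (hm : 1 ≤ m)
    (h : Module.finrank F (MvPowerSeries (Fin c) F ⧸ I) = m) :
    Ideal.span (Set.range (MvPowerSeries.X : Fin c → MvPowerSeries (Fin c) F)) ^ m ≤ I := by
  have hl := (finrank_eq_iff_length_eq (residue_surjective (c := c)) hm).1 h
  rw [span_X_eq_maximalIdeal]
  intro f hf
  have := maximalIdeal_pow_smul_eq_zero (Module.length_ne_top_iff.1
    (by rw [hl]; exact ENat.natCast_ne_top m)) hl.le f hf (Ideal.Quotient.mk I 1)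
  change Ideal.Quotient.mk I (f * 1) = 0 at this
  rwa [mul_one, Ideal.Quotient.eq_zero_iff_mem] at this

/-- Ring homomorphisms out of `F[[y]]` that kill a power of the maximal ideal are determined by
their values on constants and variables. -/
theorem ringHom_ext_of_pow {A : Type*} [CommRing A] {f g : MvPowerSeries (Fin c) F →+* A} {N : ℕ}
    (hf : Ideal.span (Set.range MvPowerSeries.X) ^ N ≤ RingHom.ker f)
    (hg : Ideal.span (Set.range MvPowerSeries.X) ^ N ≤ RingHom.ker g)
    (hC : ∀ a, f (MvPowerSeries.C a) = g (MvPowerSeries.C a))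
    (hX : ∀ i, f (MvPowerSeries.X i) = g (MvPowerSeries.X i)) : f = g := by
  have hp : f.comp MvPolynomial.coeToMvPowerSeries.ringHom =
      g.comp MvPolynomial.coeToMvPowerSeries.ringHom := by
    refine MvPolynomial.ringHom_ext (fun a => ?_) (fun i => ?_)
    · simpa using hC a
    · simpa using hX i
  ext s
  have h1 := hf (sub_truncTotal_mem N s)
  have h2 := hg (sub_truncTotal_mem N s)
  rw [RingHom.mem_ker, map_sub, sub_eq_zero] at h1 h2
  rw [h1, h2]
  exact congrArg (fun F => F (s.truncTotal N)) hp

/-- Evaluation of power series at nilpotent elements. -/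
theorem exists_eval_of_nilpotent {A : Type*} [CommRing A] (σ : F →+* A) (a : Fin c → A)
    (ha : ∀ i, IsNilpotent (a i)) : ∃ ψ : MvPowerSeries (Fin c) F →+* A,
      ∀ p : MvPolynomial (Fin c) F, ψ p = p.eval₂ σ a := by
  let : UniformSpace F := ⊥
  let : UniformSpace A := ⊥
  have : DiscreteUniformity F := ⟨rfl⟩
  have : DiscreteUniformity A := ⟨rfl⟩
  have hσ : Continuous σ := continuous_of_discreteTopology
  have hE : MvPowerSeries.HasEval a := by
    refine ⟨fun i => ?_, by simp⟩
    obtain ⟨k, hk⟩ := ha i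
    refine tendsto_const_nhds.congr' ?_
    filter_upwards [Filter.eventually_ge_atTop k] with l hl
    exact (pow_eq_zero_of_le hl hk).symm
  exact ⟨MvPowerSeries.eval₂Hom hσ hE, fun p => by
    rw [MvPowerSeries.coe_eval₂Hom, MvPowerSeries.eval₂_coe]⟩

end PowerSeries

/-! ### Macaulay duality -/

section Duality

variable {F : Type*} [Field F] {c : ℕ}

theorem diffAct_smul (a : F) (f : MvPowerSeries (Fin c) F) : diffAct (a • f) = a • diffAct f := by
  refine linearMap_ext fun β => ?_
  rw [LinearMap.smul_apply]
  simp only [diffAct_monomial, Finset.smul_sum, MvPolynomial.smul_monomial, map_smul, smul_eq_mul,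
    mul_assoc]

/-- The Macaulay pairing `(G, f) ↦ (f • G)(0)`, as a map `F[z] → Hom_F(F[[y]], F)`. -/
def macaulayPairing : MvPolynomial (Fin c) F →ₗ[F] Module.Dual F (MvPowerSeries (Fin c) F) :=
  LinearMap.mk₂ F (fun G f => MvPolynomial.constantCoeff (diffAct f G))
    (fun G H f => by simp) (fun a G f => by
      rw [map_smul, MvPolynomial.smul_eq_C_mul, map_mul, MvPolynomial.constantCoeff_C, smul_eq_mul])
    (fun G f g => by simp [diffAct_add])
    (fun a G f => by simp [diffAct_smul, MvPolynomial.smul_eq_C_mul])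

theorem macaulayPairing_apply (G : MvPolynomial (Fin c) F) (f : MvPowerSeries (Fin c) F) :
    macaulayPairing G f = MvPolynomial.constantCoeff (diffAct f G) := rfl

theorem macaulayPairing_monomial_one (β : Fin c →₀ ℕ) (f : MvPowerSeries (Fin c) F) :
    macaulayPairing (MvPolynomial.monomial β 1) f =
      MvPowerSeries.coeff β f * (derivWeight β β : F) := by
  classical
  rw [macaulayPairing_apply, diffAct_monomial, map_sum, Finset.sum_eq_single β]
  · rw [tsub_self, MvPolynomial.constantCoeff_monomial, if_pos rfl]
  · intro α hα hne
    rw [MvPolynomial.constantCoeff_monomial, if_neg]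
    rw [tsub_eq_zero_iff_le]
    exact fun h => hne (le_antisymm (Finset.mem_Iic.1 hα) h)
  · simp

theorem macaulayPairing_monomial (β : Fin c →₀ ℕ) (a : F) (f : MvPowerSeries (Fin c) F) :
    macaulayPairing (MvPolynomial.monomial β a) f =
      a * (MvPowerSeries.coeff β f * (derivWeight β β : F)) := by
  rw [← mul_one a, ← smul_eq_mul, ← MvPolynomial.smul_monomial, map_smul, LinearMap.smul_apply,
    macaulayPairing_monomial_one, smul_eq_mul, smul_eq_mul, mul_one]

/-- The monomials are dual to each other up to the weights `α!`, which are nonzero in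
characteristic `0`. -/
theorem macaulayPairing_apply_monomial (α : Fin c →₀ ℕ) (G : MvPolynomial (Fin c) F) :
    macaulayPairing G (MvPowerSeries.monomial α 1) = G.coeff α * (derivWeight α α : F) := by
  classical
  induction G using MvPolynomial.induction_on' with
  | monomial β a =>
    rw [macaulayPairing_monomial, MvPowerSeries.coeff_monomial, MvPolynomial.coeff_monomial]
    by_cases h : β = α
    · subst h; simp
    · simp [h]
  | add p q hp hq => rw [map_add, LinearMap.add_apply, hp, hq, MvPolynomial.coeff_add, add_mul]

/-- Multiplication by `g` on `F[[y]]` is adjoint to the action of `g` on `F[z]`. -/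
theorem macaulayPairing_mul (f g : MvPowerSeries (Fin c) F) (G : MvPolynomial (Fin c) F) :
    macaulayPairing G (f * g) = macaulayPairing (diffAct g G) f := by
  rw [macaulayPairing_apply, diffAct_mul, LinearMap.comp_apply, macaulayPairing_apply]

theorem diffAct_C (a : F) (G : MvPolynomial (Fin c) F) :
    diffAct (MvPolynomial.C a : MvPolynomial (Fin c) F) G = a • G := by
  have h1 : diffAct (1 : MvPowerSeries (Fin c) F) = LinearMap.id := by
    classical
    refine linearMap_ext fun β => ?_
    rw [diffAct_monomial, Finset.sum_eq_single 0]
    · simp [derivWeight]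
    · intro α _ hα
      rw [MvPowerSeries.coeff_one, if_neg hα, zero_mul, map_zero]
    · simp
  rw [MvPolynomial.coe_C, ← mul_one (MvPowerSeries.C a), ← MvPowerSeries.smul_eq_C_mul,
    diffAct_smul, LinearMap.smul_apply, h1, LinearMap.id_apply]

/-- A subspace closed under differentiation is stable under all constant-coefficient operators. -/
theorem diffAct_coe_mem {V : Submodule F (MvPolynomial (Fin c) F)}
    (hV : ∀ i, ∀ G ∈ V, MvPolynomial.pderiv i G ∈ V) (p : MvPolynomial (Fin c) F)
    {G : MvPolynomial (Fin c) F} (hG : G ∈ V) :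
    diffAct (p : MvPowerSeries (Fin c) F) G ∈ V := by
  induction p using MvPolynomial.induction_on generalizing G with
  | C a =>
    rw [diffAct_C]
    exact V.smul_mem a hG
  | add p q hp hq =>
    rw [MvPolynomial.coe_add, diffAct_add, LinearMap.add_apply]
    exact V.add_mem (hp hG) (hq hG)
  | mul_X p i hp =>
    rw [MvPolynomial.coe_mul, diffAct_mul, LinearMap.comp_apply, MvPolynomial.coe_X, diffAct_X]
    exact hp (hV i G hG)

theorem inverseSystem_pderiv_mem (I : Ideal (MvPowerSeries (Fin c) F)) (i : Fin c)
    {G : MvPolynomial (Fin c) F} (hG : G ∈ inverseSystem I) :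
    MvPolynomial.pderiv i G ∈ inverseSystem I := by
  simp only [inverseSystem, Submodule.mem_iInf, LinearMap.mem_ker] at hG ⊢
  intro f hf
  have := hG (f * MvPowerSeries.X i) (I.mul_mem_right _ hf)
  rwa [diffAct_mul, LinearMap.comp_apply, diffAct_X] at this

theorem finrank_dualAnnihilator_restrictScalars (I : Ideal (MvPowerSeries (Fin c) F)) :
    Module.finrank F (I.restrictScalars F).dualAnnihilator =
      Module.finrank F (MvPowerSeries (Fin c) F ⧸ I) := by
  rw [← (Submodule.dualQuotEquivDualAnnihilator _).finrank_eq, Subspace.dual_finrank_eq]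
  exact (Submodule.Quotient.restrictScalarsEquiv F I).finrank_eq

variable [CharZero F]

theorem derivWeight_self_ne_zero (α : Fin c →₀ ℕ) : (derivWeight α α : F) ≠ 0 := by
  rw [derivWeight, Nat.cast_ne_zero, Finset.prod_ne_zero_iff]
  intro i _
  rw [Nat.descFactorial_self]
  exact Nat.factorial_ne_zero _

theorem eq_zero_of_macaulayPairing_monomial {G : MvPolynomial (Fin c) F}
    (h : ∀ α, macaulayPairing G (MvPowerSeries.monomial α 1) = 0) : G = 0 := by
  ext α
  have := h α
  rw [macaulayPairing_apply_monomial, mul_eq_zero] at this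
  simpa using this.resolve_right (derivWeight_self_ne_zero α)

theorem macaulayPairing_injective :
    Function.Injective (macaulayPairing : MvPolynomial (Fin c) F →ₗ[F] _) := by
  refine (injective_iff_map_eq_zero _).2 fun G hG => eq_zero_of_macaulayPairing_monomial fun α => ?_
  rw [hG, LinearMap.zero_apply]

/-- Since `I` is an ideal, `f • G` vanishes for all `f ∈ I` as soon as its constant term does: the
inverse system is the orthogonal complement of `I` for the pairing. -/
theorem inverseSystem_eq_comap (I : Ideal (MvPowerSeries (Fin c) F)) :
    inverseSystem I =
      ((I.restrictScalars F).dualAnnihilator).comap macaulayPairing := by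
  ext G
  simp only [inverseSystem, Submodule.mem_iInf, LinearMap.mem_ker, Submodule.mem_comap,
    Submodule.mem_dualAnnihilator, Submodule.restrictScalars_mem]
  constructor
  · intro h f hf
    rw [macaulayPairing_apply, h f hf, map_zero]
  · intro h f hf
    refine eq_zero_of_macaulayPairing_monomial fun α => ?_
    rw [← macaulayPairing_mul]
    exact h _ (I.mul_mem_left _ hf)

theorem mem_annihilator_iff {V : Submodule F (MvPolynomial (Fin c) F)}
    (hV : ∀ i, ∀ G ∈ V, MvPolynomial.pderiv i G ∈ V) (f : MvPowerSeries (Fin c) F) :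
    f ∈ annihilator V ↔ ∀ G ∈ V, macaulayPairing G f = 0 := by
  change (∀ G ∈ V, diffAct f G = 0) ↔ _
  constructor
  · intro h G hG
    rw [macaulayPairing_apply, h G hG, map_zero]
  · intro h G hG
    refine eq_zero_of_macaulayPairing_monomial fun α => ?_
    rw [← macaulayPairing_mul, mul_comm, macaulayPairing_mul]
    have := h _ (diffAct_coe_mem hV (MvPolynomial.monomial α 1) hG)
    rwa [MvPolynomial.coe_monomial] at this

/-- The annihilator of a subspace closed under differentiation is its orthogonal complement for the
pairing. -/
theorem annihilator_eq {V : Submodule F (MvPolynomial (Fin c) F)}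
    (hV : ∀ i, ∀ G ∈ V, MvPolynomial.pderiv i G ∈ V) :
    (annihilator V).restrictScalars F = (V.map macaulayPairing).dualCoannihilator := by
  ext f
  rw [Submodule.restrictScalars_mem, mem_annihilator_iff hV, Submodule.mem_dualCoannihilator]
  simp

/-- A functional on `F[[y]]` that vanishes on a power of the maximal ideal is the pairing with a
polynomial. -/
theorem exists_macaulayPairing_eq {N : ℕ} (φ : Module.Dual F (MvPowerSeries (Fin c) F))
    (hφ : ∀ f ∈ Ideal.span (Set.range (MvPowerSeries.X : Fin c → MvPowerSeries (Fin c) F)) ^ N,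
      φ f = 0) : ∃ G, macaulayPairing G = φ := by
  classical
  refine ⟨∑ α ∈ (Finsupp.finite_of_degree_lt (σ := Fin c) N).toFinset, MvPolynomial.monomial α
    (φ (MvPowerSeries.monomial α 1) / (derivWeight α α : F)), LinearMap.ext fun f => ?_⟩
  have h := hφ _ (sub_truncTotal_mem N f)
  rw [map_sub, sub_eq_zero] at h
  have hsum : (f.truncTotal N : MvPowerSeries (Fin c) F) =
      ∑ α ∈ (Finsupp.finite_of_degree_lt (σ := Fin c) N).toFinset,
        MvPowerSeries.coeff α f • MvPowerSeries.monomial α (1 : F) := by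
    ext β
    rw [MvPolynomial.coeff_coe, MvPowerSeries.coeff_truncTotal_eq_ite, map_sum]
    simp [MvPowerSeries.coeff_monomial]
  rw [h, hsum, map_sum, map_sum, LinearMap.sum_apply]
  refine Finset.sum_congr rfl fun α _ => ?_
  rw [macaulayPairing_monomial, map_smul, smul_eq_mul]
  field_simp [derivWeight_self_ne_zero (F := F) α]

theorem map_inverseSystem {I : Ideal (MvPowerSeries (Fin c) F)} {N : ℕ}
    (hI : Ideal.span (Set.range MvPowerSeries.X) ^ N ≤ I) :
    (inverseSystem I).map macaulayPairing = (I.restrictScalars F).dualAnnihilator := by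
  rw [inverseSystem_eq_comap, Submodule.map_comap_eq_self]
  intro φ hφ
  rw [Submodule.mem_dualAnnihilator] at hφ
  exact exists_macaulayPairing_eq φ fun f hf => hφ f (hI hf)

theorem annihilator_inverseSystem {I : Ideal (MvPowerSeries (Fin c) F)} {N : ℕ}
    (hI : Ideal.span (Set.range MvPowerSeries.X) ^ N ≤ I) :
    annihilator (inverseSystem I) = I := by
  refine Submodule.restrictScalars_injective F _ _ ?_
  rw [annihilator_eq fun i G => inverseSystem_pderiv_mem I i, map_inverseSystem hI]
  exact Subspace.dualAnnihilator_dualCoannihilator_eq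

theorem inverseSystem_annihilator {V : Submodule F (MvPolynomial (Fin c) F)}
    [FiniteDimensional F V] (hV : ∀ i, ∀ G ∈ V, MvPolynomial.pderiv i G ∈ V) :
    inverseSystem (annihilator V) = V := by
  rw [inverseSystem_eq_comap, annihilator_eq hV,
    Subspace.dualCoannihilator_dualAnnihilator_eq,
    Submodule.comap_map_eq_of_injective macaulayPairing_injective]

/-- Macaulay's correspondence between ideals of colength `m` and their inverse systems. -/
theorem macaulay_correspondence {m : ℕ} (hm : 1 ≤ m) :
    Set.BijOn inverseSystem (hilbPoints F c m) (diffClosedSubspaces F c m) ∧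
      Set.InvOn annihilator inverseSystem (hilbPoints F c m) (diffClosedSubspaces F c m) := by
  have hinv : Set.InvOn annihilator inverseSystem (hilbPoints F c m)
      (diffClosedSubspaces F c m) := by
    refine ⟨fun I hI => annihilator_inverseSystem (span_X_pow_le_of_finrank hm hI),
      fun V hV => ?_⟩
    have : FiniteDimensional F V := Module.finite_of_finrank_pos (by rw [hV.1]; omega)
    exact inverseSystem_annihilator hV.2
  refine ⟨hinv.bijOn (fun I hI => ⟨?_, fun i G => inverseSystem_pderiv_mem I i⟩)
    fun V hV => ?_, hinv⟩
  · rw [(Submodule.equivMapOfInjective _ macaulayPairing_injective (inverseSystem I)).finrank_eq,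
      map_inverseSystem (span_X_pow_le_of_finrank hm hI), finrank_dualAnnihilator_restrictScalars]
    exact hI
  · have : FiniteDimensional F V := Module.finite_of_finrank_pos (by rw [hV.1]; omega)
    change Module.finrank F (_ ⧸ annihilator V) = m
    rw [← finrank_dualAnnihilator_restrictScalars, annihilator_eq hV.2,
      Subspace.dualCoannihilator_dualAnnihilator_eq,
      ← (Submodule.equivMapOfInjective _ macaulayPairing_injective V).finrank_eq, hV.1]

end Duality

/-! ### The Weyl-Noether module as a module of differential operators -/

section DifferentialOperators

variable {K : Type*} [Field K] {n c : ℕ}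

namespace RelWeyl

theorem d_mul_d (e : Fin c ↪ Fin n) (i j : Fin c) :
    (d e i * d e j : RelWeyl K e) = d e j * d e i := by
  have h := RingQuot.mkAlgHom_rel K (WeylRel.d_comm (K := K) (e := e) i j)
  rw [map_mul, map_mul] at h
  exact h

theorem d_mul_x_of_ne (e : Fin c ↪ Fin n) {i : Fin c} {j : Fin n} (hij : e i ≠ j) :
    (d e i * x e j : RelWeyl K e) = x e j * d e i := by
  have h := RingQuot.mkAlgHom_rel K (WeylRel.d_x_comm (K := K) (e := e) i j hij)
  rw [map_mul, map_mul] at h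
  exact h

theorem d_mul_x_self (e : Fin c ↪ Fin n) (i : Fin c) :
    (d e i * x e (e i) : RelWeyl K e) = x e (e i) * d e i + 1 := by
  have h := RingQuot.mkAlgHom_rel K (WeylRel.d_x_self (K := K) (e := e) i)
  rw [map_add, map_mul, map_mul, map_one] at h
  exact h

open scoped IsMulCommutative in
/-- The `K`-algebra map from polynomials to constant-coefficient operators. -/
def ofSymbol (e : Fin c ↪ Fin n) : MvPolynomial (Fin c) K →ₐ[K] RelWeyl K e :=
  haveI : IsMulCommutative (Algebra.adjoin K (Set.range (d (K := K) e))) :=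
    Algebra.isMulCommutative_adjoin K (by
      rintro _ ⟨i, rfl⟩ _ ⟨j, rfl⟩
      exact d_mul_d e i j)
  (Algebra.adjoin K (Set.range (d (K := K) e))).val.comp
    (MvPolynomial.aeval fun j => ⟨d e j, Algebra.subset_adjoin ⟨j, rfl⟩⟩)

theorem ofSymbol_X (e : Fin c ↪ Fin n) (i : Fin c) :
    ofSymbol e (MvPolynomial.X i) = (d e i : RelWeyl K e) := by
  simp [ofSymbol]

theorem dPow_eq_ofSymbol (e : Fin c ↪ Fin n) (α : Fin c →₀ ℕ) :
    (dPow e α : RelWeyl K e) = ofSymbol e (MvPolynomial.monomial α 1) := by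
  rw [MvPolynomial.monomial_eq, MvPolynomial.C_1, one_mul,
    Finsupp.prod_fintype _ _ (fun i => pow_zero _), ← List.prod_ofFn, map_list_prod,
    List.map_ofFn, dPow]
  congr 2
  funext i
  rw [Function.comp_apply, map_pow, ofSymbol_X]

theorem dPow_zero (e : Fin c ↪ Fin n) : (dPow e 0 : RelWeyl K e) = 1 := by
  rw [dPow_eq_ofSymbol, ← MvPolynomial.one_def, map_one]

theorem dPow_add (e : Fin c ↪ Fin n) (α β : Fin c →₀ ℕ) :
    (dPow e (α + β) : RelWeyl K e) = dPow e α * dPow e β := by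
  rw [dPow_eq_ofSymbol, dPow_eq_ofSymbol, dPow_eq_ofSymbol, ← map_mul, MvPolynomial.monomial_mul,
    one_mul]

theorem dPow_single (e : Fin c ↪ Fin n) (i : Fin c) :
    (dPow e (Finsupp.single i 1) : RelWeyl K e) = d e i := by
  rw [dPow_eq_ofSymbol, ← ofSymbol_X]
  rfl

/-- The Leibniz rule `∂_i r = r ∂_i + ∂_i(r)` in the relative Weyl algebra. -/
theorem d_mul_ofPoly (e : Fin c ↪ Fin n) (i : Fin c) (r : MvPolynomial (Fin n) K) :
    d e i * ofPoly e r = ofPoly e r * d e i + ofPoly e (MvPolynomial.pderiv (e i) r) := by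
  induction r using MvPolynomial.induction_on with
  | C a =>
    rw [MvPolynomial.pderiv_C, map_zero, add_zero, ← MvPolynomial.algebraMap_eq, AlgHom.commutes]
    exact (Algebra.commutes a _).symm
  | add p q hp hq => simp only [map_add, mul_add, add_mul, hp, hq]; abel
  | mul_X p j hp =>
    have hx : d e i * x e j = x e j * d e i +
        ofPoly (K := K) e (MvPolynomial.pderiv (e i) (MvPolynomial.X j)) := by
      by_cases hij : e i = j
      · subst hij
        rw [d_mul_x_self, MvPolynomial.pderiv_X_self, map_one]
      · rw [d_mul_x_of_ne e hij, MvPolynomial.pderiv_X_of_ne (Ne.symm hij), map_zero, add_zero]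
    rw [map_mul, ofPoly_X, ← mul_assoc, hp, add_mul, mul_assoc, hx, Derivation.leibniz, map_add,
      smul_eq_mul, smul_eq_mul, map_mul, mul_add, mul_assoc, add_assoc,
      mul_comm (MvPolynomial.X j), map_mul, ofPoly_X]

theorem adjoin_generators (e : Fin c ↪ Fin n) :
    Algebra.adjoin K (Set.range (x e) ∪ Set.range (d e)) = (⊤ : Subalgebra K (RelWeyl K e)) := by
  refine eq_top_iff.2 fun a _ => ?_
  obtain ⟨b, rfl⟩ := RingQuot.mkAlgHom_surjective K (WeylRel K e) a
  induction b using FreeAlgebra.induction with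
  | grade0 r =>
    rw [AlgHom.commutes]
    exact Subalgebra.algebraMap_mem _ r
  | grade1 j =>
    refine Algebra.subset_adjoin ?_
    obtain j | i := j
    · exact Or.inl ⟨j, rfl⟩
    · exact Or.inr ⟨i, rfl⟩
  | mul a b ha hb =>
    rw [map_mul]
    exact Subalgebra.mul_mem _ (ha trivial) (hb trivial)
  | add a b ha hb =>
    rw [map_add]
    exact Subalgebra.add_mem _ (ha trivial) (hb trivial)

/-- The monomials `∂^α` generate `D_{n,c}` as a left `R`-module. -/
theorem span_dPow (e : Fin c ↪ Fin n) :
    Submodule.span (MvPolynomial (Fin n) K) (Set.range (dPow e)) =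
      (⊤ : Submodule _ (RelWeyl K e)) := by
  set N := Submodule.span (MvPolynomial (Fin n) K) (Set.range (dPow (K := K) e)) with hN
  have hd : ∀ i, ∀ a ∈ N, d e i * a ∈ N := by
    intro i a ha
    induction ha using Submodule.span_induction with
    | mem a ha =>
      obtain ⟨α, rfl⟩ := ha
      rw [← dPow_single, ← dPow_add]
      exact Submodule.subset_span ⟨_, rfl⟩
    | zero => rw [mul_zero]; exact N.zero_mem
    | add a b _ _ ha hb => rw [mul_add]; exact N.add_mem ha hb
    | smul r a ha ih =>
      rw [smul_def, ← mul_assoc, d_mul_ofPoly, add_mul, mul_assoc, ← smul_def, ← smul_def]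
      exact N.add_mem (N.smul_mem _ ih) (N.smul_mem _ ha)
  have h1 : (1 : RelWeyl K e) ∈ N := Submodule.subset_span ⟨0, dPow_zero e⟩
  refine eq_top_iff.2 fun a _ => ?_
  suffices h : ∀ b ∈ N, a * b ∈ N by simpa using h 1 h1
  have ha : a ∈ Algebra.adjoin K (Set.range (x e) ∪ Set.range (d (K := K) e)) := by
    rw [adjoin_generators]; trivial
  induction ha using Algebra.adjoin_induction with
  | mem a ha =>
    obtain ⟨j, rfl⟩ | ⟨i, rfl⟩ := ha
    · intro b hb
      rw [← ofPoly_X, ← smul_def]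
      exact N.smul_mem _ hb
    · exact hd i
  | algebraMap r =>
    intro b hb
    rw [← AlgHom.commutes (ofPoly e), ← smul_def]
    exact N.smul_mem _ hb
  | add a b _ _ ha hb =>
    intro v hv
    rw [add_mul]
    exact N.add_mem (ha trivial v hv) (hb trivial v hv)
  | mul a b _ _ ha hb =>
    intro v hv
    rw [mul_assoc]
    exact ha trivial _ (hb trivial v hv)

theorem act_ofPoly (e : Fin c ↪ Fin n) (r f : MvPolynomial (Fin n) K) :
    act e (ofPoly e r) f = r * f := by
  have h : (act e).comp (ofPoly e) = Algebra.lmul K (MvPolynomial (Fin n) K) := by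
    refine MvPolynomial.algHom_ext fun j => LinearMap.ext fun f => ?_
    rw [AlgHom.comp_apply, ofPoly_X, act_x]
    rfl
  exact congrArg (fun T => T r f) h

end RelWeyl

section Evaluation

variable (P : Ideal (MvPolynomial (Fin n) K)) [P.IsPrime] (e : Fin c ↪ Fin n)

theorem algebraMap_resField_eq_zero_iff (f : MvPolynomial (Fin n) K) :
    algebraMap (MvPolynomial (Fin n) K) (ResField P) f = 0 ↔ f ∈ P := by
  rw [IsScalarTower.algebraMap_apply _ (MvPolynomial (Fin n) K ⧸ P) (ResField P),
    FaithfulSMul.algebraMap_eq_zero_iff, Ideal.Quotient.algebraMap_eq,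
    Ideal.Quotient.eq_zero_iff_mem]

/-- Every element of `Quot(R/P)` has the form `s⁻¹ r` with `r, s ∈ R` and `s ∉ P`. -/
theorem exists_smul_eq_algebraMap (a : ResField P) : ∃ s ∉ P, ∃ r : MvPolynomial (Fin n) K,
    s • a = algebraMap (MvPolynomial (Fin n) K) (ResField P) r := by
  obtain ⟨⟨r, s⟩, h⟩ := IsLocalization.surj (nonZeroDivisors (MvPolynomial (Fin n) K ⧸ P)) a
  obtain ⟨r, rfl⟩ := Ideal.Quotient.mk_surjective r
  obtain ⟨s, hs⟩ := s
  obtain ⟨s, rfl⟩ := Ideal.Quotient.mk_surjective s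
  refine ⟨s, fun h0 => nonZeroDivisors.ne_zero hs (Ideal.Quotient.eq_zero_iff_mem.2 h0), r, ?_⟩
  rw [Algebra.smul_def, mul_comm]
  exact h

theorem gamma_C (a : K) : gamma P e (MvPolynomial.C a) =
    MvPolynomial.C (algebraMap (MvPolynomial (Fin n) K) (ResField P) (MvPolynomial.C a)) := by
  rw [← MvPolynomial.algebraMap_eq, AlgHom.commutes,
    ← IsScalarTower.algebraMap_apply K (MvPolynomial (Fin n) K) (ResField P),
    ← MvPolynomial.algebraMap_eq, ← IsScalarTower.algebraMap_apply]

theorem gamma_X_self (i : Fin c) : gamma P e (MvPolynomial.X (e i)) =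
    MvPolynomial.C (algebraMap (MvPolynomial (Fin n) K) (ResField P) (MvPolynomial.X (e i))) +
      MvPolynomial.X i := by
  simp [gamma]

theorem gamma_X_of_notMem {j : Fin n} (hj : j ∉ Set.range e) : gamma P e (MvPolynomial.X j) =
    MvPolynomial.C (algebraMap (MvPolynomial (Fin n) K) (ResField P) (MvPolynomial.X j)) := by
  rw [gamma, MvPolynomial.aeval_X, Finset.sum_eq_zero, add_zero]
  exact fun i _ => if_neg fun h => hj ⟨i, h⟩

/-- The constant coefficient of `γ(f)` is the residue class of `f`. -/
theorem constantCoeff_gamma (f : MvPolynomial (Fin n) K) :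
    MvPolynomial.constantCoeff (gamma P e f) =
      algebraMap (MvPolynomial (Fin n) K) (ResField P) f := by
  have h : MvPolynomial.constantCoeff.comp (gamma P e).toRingHom =
      algebraMap (MvPolynomial (Fin n) K) (ResField P) := by
    refine MvPolynomial.ringHom_ext (fun a => ?_) fun j => ?_
    · rw [RingHom.comp_apply]
      exact (congrArg _ (gamma_C P e a)).trans (MvPolynomial.constantCoeff_C _ _)
    · by_cases hj : j ∈ Set.range e
      · obtain ⟨i, rfl⟩ := hj
        simp [gamma_X_self]
      · simp [gamma_X_of_notMem P e hj]
  exact congrArg (fun T => T f) h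

/-- `γ` intertwines `∂_{x_{e i}}` and `∂_{y_i}`. -/
theorem gamma_pderiv (i : Fin c) (f : MvPolynomial (Fin n) K) :
    gamma P e (MvPolynomial.pderiv (e i) f) = MvPolynomial.pderiv i (gamma P e f) := by
  classical
  induction f using MvPolynomial.induction_on with
  | C a => rw [MvPolynomial.pderiv_C, map_zero, gamma_C, MvPolynomial.pderiv_C]
  | add p q hp hq => simp only [map_add, hp, hq]
  | mul_X p j hp =>
    have hX : gamma P e (MvPolynomial.pderiv (e i) (MvPolynomial.X j)) =
        MvPolynomial.pderiv i (gamma P e (MvPolynomial.X j)) := by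
      by_cases hj : j ∈ Set.range e
      · obtain ⟨k, rfl⟩ := hj
        rw [gamma_X_self, map_add, MvPolynomial.pderiv_C, zero_add]
        by_cases hk : k = i
        · subst hk
          rw [MvPolynomial.pderiv_X_self, MvPolynomial.pderiv_X_self, map_one]
        · rw [MvPolynomial.pderiv_X_of_ne hk,
            MvPolynomial.pderiv_X_of_ne (fun h => hk (e.injective h)), map_zero]
      · rw [gamma_X_of_notMem P e hj, MvPolynomial.pderiv_C,
          MvPolynomial.pderiv_X_of_ne (fun h => hj ⟨i, h.symm⟩), map_zero]
    simp only [Derivation.leibniz, map_add, smul_eq_mul, map_mul, hp, hX]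

theorem gammaHat_apply (f : MvPolynomial (Fin n) K) :
    gammaHat P e f = (gamma P e f : MvPowerSeries (Fin c) (ResField P)) := rfl

/-- The `F`-span of the image of an algebra homomorphism is a subalgebra. -/
theorem span_range_algHom {k F A B : Type*} [CommRing k] [Field F] [CommRing A] [CommRing B]
    [Algebra k A] [Algebra k B] [Algebra F B] (g : A →ₐ[k] B) :
    Submodule.span F (Set.range g) =
      Subalgebra.toSubmodule (Algebra.adjoin F (Set.range g)) := by
  have h := Submonoid.closure_eq g.range.toSubmonoid
  rw [Algebra.adjoin_eq_span]
  congr 1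
  exact (congrArg (fun M : Submonoid B => (M : Set B)) h).symm

/-- The polynomial ring `F[y]` is spanned over `F` by `γ(R)`. -/
theorem span_range_gamma :
    Submodule.span (ResField P) (Set.range (gamma P e)) = ⊤ := by
  rw [span_range_algHom, ← Algebra.top_toSubmodule]
  congr 1
  rw [← top_le_iff, ← MvPolynomial.adjoin_range_X]
  refine Algebra.adjoin_le ?_
  rintro _ ⟨i, rfl⟩
  have h2 := Algebra.subset_adjoin (R := ResField P)
    (Set.mem_range_self (f := gamma P e) (MvPolynomial.X (e i)))
  rw [gamma_X_self] at h2
  have h3 := Subalgebra.sub_mem _ h2 (Subalgebra.algebraMap_mem _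
    (algebraMap (MvPolynomial (Fin n) K) (ResField P) (MvPolynomial.X (e i))))
  rwa [MvPolynomial.algebraMap_eq, add_sub_cancel_left] at h3

/-- The action of the Weyl-Noether module on `R` with values in `F`: `a ⊗ A` sends `f` to `a` times
the residue class of `A • f`. -/
def evalOp : WeylNoether P e →ₗ[ResField P] (MvPolynomial (Fin n) K → ResField P) :=
  LinearMap.liftBaseChange (ResField P)
    { toFun := fun A f => algebraMap (MvPolynomial (Fin n) K) (ResField P) (RelWeyl.act e A f)
      map_add' := fun A B => by
        funext f
        rw [map_add, LinearMap.add_apply, map_add]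
        rfl
      map_smul' := fun r A => by
        funext f
        rw [RelWeyl.smul_def, map_mul, Module.End.mul_apply, RelWeyl.act_ofPoly, map_mul,
          RingHom.id_apply, Pi.smul_apply, Algebra.smul_def] }

theorem evalOp_tmul (a : ResField P) (A : RelWeyl K e) (f : MvPolynomial (Fin n) K) :
    evalOp P e (a ⊗ₜ A) f =
      a * algebraMap (MvPolynomial (Fin n) K) (ResField P) (RelWeyl.act e A f) := by
  rw [evalOp, LinearMap.liftBaseChange_tmul]
  rfl

theorem omega_monomial (α : Fin c →₀ ℕ) (a : ResField P) :
    omega P e (MvPolynomial.monomial α a) = a ⊗ₜ RelWeyl.dPow e α := by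
  have h := (MvPolynomial.basisMonomials (Fin c) (ResField P)).constr_basis (ResField P) (fun α =>
    (1 : ResField P) ⊗ₜ[MvPolynomial (Fin n) K] (RelWeyl.dPow e α : RelWeyl K e)) α
  rw [MvPolynomial.coe_basisMonomials] at h
  rw [← mul_one a, ← smul_eq_mul, ← MvPolynomial.smul_monomial, map_smul,
    ← TensorProduct.smul_tmul']
  exact congrArg (a • ·) h

/-- The Taylor coefficients at the generic point of `∂^α f` in terms of those of `f`. -/
theorem coeff_gamma_act_dPow (α δ : Fin c →₀ ℕ) (f : MvPolynomial (Fin n) K) :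
    (gamma P e (RelWeyl.act e (RelWeyl.dPow e α) f)).coeff δ =
      (gamma P e f).coeff (δ + α) * (derivWeight (δ + α) α : ResField P) := by
  classical
  have hadd : ∀ α β : Fin c →₀ ℕ,
      (∀ δ f, (gamma P e (RelWeyl.act e (RelWeyl.dPow e α) f)).coeff δ =
        (gamma P e f).coeff (δ + α) * (derivWeight (δ + α) α : ResField P)) →
      (∀ δ f, (gamma P e (RelWeyl.act e (RelWeyl.dPow e β) f)).coeff δ =
        (gamma P e f).coeff (δ + β) * (derivWeight (δ + β) β : ResField P)) →
      ∀ δ f, (gamma P e (RelWeyl.act e (RelWeyl.dPow e (α + β)) f)).coeff δ =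
        (gamma P e f).coeff (δ + (α + β)) * (derivWeight (δ + (α + β)) (α + β) : ResField P) := by
    intro α β hα hβ δ f
    rw [RelWeyl.dPow_add, map_mul, Module.End.mul_apply, hα, hβ, derivWeight_add, ← add_assoc,
      add_tsub_cancel_right, Nat.cast_mul, mul_assoc]
  have hzero : ∀ δ f, (gamma P e (RelWeyl.act e (RelWeyl.dPow e 0) f)).coeff δ =
        (gamma P e f).coeff (δ + 0) * (derivWeight (δ + 0) 0 : ResField P) := by
    intro δ f
    rw [RelWeyl.dPow_zero, map_one, Module.End.one_apply]
    simp [derivWeight]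
  induction α using Finsupp.induction_linear generalizing f δ with
  | zero => exact hzero δ f
  | add α β hα hβ => exact hadd α β (fun δ f => hα δ f) (fun δ f => hβ δ f) δ f
  | single i k =>
    induction k generalizing δ f with
    | zero => rw [Finsupp.single_zero]; exact hzero δ f
    | succ k ih =>
      rw [Finsupp.single_add]
      refine hadd _ _ (fun δ f => ih δ f) (fun δ f => ?_) δ f
      rw [RelWeyl.dPow_single, RelWeyl.act_d, gamma_pderiv, MvPolynomial.coeff_pderiv, derivWeight,
        Finset.prod_eq_single i]
      · simp
      · intro j _ hj
        simp [Finsupp.single_eq_of_ne hj]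
      · simp

theorem algebraMap_act_dPow (α : Fin c →₀ ℕ) (f : MvPolynomial (Fin n) K) :
    algebraMap (MvPolynomial (Fin n) K) (ResField P) (RelWeyl.act e (RelWeyl.dPow e α) f) =
      (gamma P e f).coeff α * (derivWeight α α : ResField P) := by
  rw [← constantCoeff_gamma P e, MvPolynomial.constantCoeff_eq, coeff_gamma_act_dPow, zero_add]

/-- The operator `ω(G)` acts on `R` through the Macaulay pairing of `γ(f)` with `G`. -/
theorem evalOp_omega (G : MvPolynomial (Fin c) (ResField P)) (f : MvPolynomial (Fin n) K) :
    evalOp P e (omega P e G) f = macaulayPairing G (gammaHat P e f) := by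
  induction G using MvPolynomial.induction_on' with
  | monomial β a =>
    rw [omega_monomial, evalOp_tmul, algebraMap_act_dPow, macaulayPairing_monomial,
      gammaHat_apply, MvPolynomial.coeff_coe]
  | add p q hp hq => rw [map_add, map_add, Pi.add_apply, hp, hq, map_add, LinearMap.add_apply]

theorem omega_surjective : Function.Surjective (omega P e) := by
  rw [← LinearMap.range_eq_top, ← top_le_iff]
  intro w _
  induction w using TensorProduct.induction_on with
  | zero => exact Submodule.zero_mem _
  | add v w hv hw => exact Submodule.add_mem _ (hv trivial) (hw trivial)
  | tmul a A =>
    have hA : A ∈ Submodule.span (MvPolynomial (Fin n) K) (Set.range (RelWeyl.dPow e)) := by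
      rw [RelWeyl.span_dPow]; trivial
    induction hA using Submodule.span_induction generalizing a with
    | mem A hA =>
      obtain ⟨α, rfl⟩ := hA
      exact ⟨_, omega_monomial P e α a⟩
    | zero => rw [TensorProduct.tmul_zero]; exact Submodule.zero_mem _
    | add A B _ _ hA hB =>
      rw [TensorProduct.tmul_add]
      exact Submodule.add_mem _ (hA a trivial) (hB a trivial)
    | smul r A _ hA =>
      rw [← TensorProduct.smul_tmul]
      exact hA _ trivial

theorem evalOp_rightAct (r : MvPolynomial (Fin n) K) (w : WeylNoether P e)
    (f : MvPolynomial (Fin n) K) :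
    evalOp P e (rightAct P e r w) f = evalOp P e w (r * f) := by
  induction w using TensorProduct.induction_on with
  | zero => simp only [map_zero, Pi.zero_apply]
  | add v w hv hw => simp only [map_add, Pi.add_apply, hv, hw]
  | tmul a A =>
    rw [rightAct, LinearMap.baseChange_tmul, evalOp_tmul, evalOp_tmul]
    change a * algebraMap _ _ (RelWeyl.act e (A * RelWeyl.ofPoly e r) f) = _
    rw [map_mul, Module.End.mul_apply, RelWeyl.act_ofPoly]

/-- Denominators can be cleared in the Weyl-Noether module. -/
theorem exists_lift_weylNoether (w : WeylNoether P e) : ∃ A : RelWeyl K e, ∃ s ∉ P,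
    (1 : ResField P) ⊗ₜ[MvPolynomial (Fin n) K] A = s • w := by
  induction w using TensorProduct.induction_on with
  | zero => exact ⟨0, 1, P.one_notMem, by simp⟩
  | tmul a A =>
    obtain ⟨s, hs, r, hr⟩ := exists_smul_eq_algebraMap P a
    refine ⟨r • A, s, hs, ?_⟩
    rw [TensorProduct.smul_tmul', hr, ← TensorProduct.smul_tmul, Algebra.smul_def, mul_one]
  | add v w hv hw =>
    obtain ⟨A, s, hs, hA⟩ := hv
    obtain ⟨B, t, ht, hB⟩ := hw
    refine ⟨t • A + s • B, s * t, fun h => ?_, ?_⟩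
    · exact (Ideal.IsPrime.mem_or_mem ‹_› h).elim hs ht
    · rw [TensorProduct.tmul_add, TensorProduct.tmul_smul, TensorProduct.tmul_smul, hA, hB,
        smul_add, smul_smul, smul_smul, mul_comm t s]

variable [CharZero K]

instance : CharZero (ResField P) := charZero_of_injective_algebraMap (algebraMap K _).injective

/-- Both injectivities follow from that of the composite `G ↦ (f ↦ ⟨γ(f), G⟩)`, as `γ(R)` spans
`F[y]` over `F`. -/
theorem omega_injective_and_evalOp_injective :
    Function.Injective (omega P e) ∧ Function.Injective (evalOp P e) := by
  have hcomp : Function.Injective (evalOp P e ∘ₗ omega P e) := by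
    refine (injective_iff_map_eq_zero _).2 fun G hG => eq_zero_of_macaulayPairing_monomial fun α => ?_
    have h : ∀ p : MvPolynomial (Fin c) (ResField P),
        macaulayPairing G (p : MvPowerSeries _ _) = 0 := by
      intro p
      have hp : p ∈ Submodule.span (ResField P) (Set.range (gamma P e)) := by
        rw [span_range_gamma]; trivial
      induction hp using Submodule.span_induction with
      | mem p hp =>
        obtain ⟨f, rfl⟩ := hp
        rw [← gammaHat_apply, ← evalOp_omega]
        exact congrFun hG f
      | zero => rw [MvPolynomial.coe_zero, map_zero]
      | add p q _ _ hp hq => rw [MvPolynomial.coe_add, map_add, hp, hq, add_zero]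
      | smul a p _ hp => rw [MvPolynomial.coe_smul, map_smul, hp, smul_zero]
    have := h (MvPolynomial.monomial α 1)
    rwa [MvPolynomial.coe_monomial] at this
  refine ⟨Function.Injective.of_comp hcomp, fun v w hvw => ?_⟩
  obtain ⟨G, rfl⟩ := omega_surjective P e v
  obtain ⟨H, rfl⟩ := omega_surjective P e w
  rw [hcomp hvw]

/-- Under `ω`, the right action of `r` becomes the action of the differential operator `γ(r)`. -/
theorem rightAct_omega (r : MvPolynomial (Fin n) K) (G : MvPolynomial (Fin c) (ResField P)) :
    rightAct P e r (omega P e G) = omega P e (diffAct (gammaHat P e r) G) := by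
  refine (omega_injective_and_evalOp_injective P e).2 (funext fun f => ?_)
  rw [evalOp_rightAct, evalOp_omega, evalOp_omega, ← macaulayPairing_mul, ← map_mul, mul_comm]

/-- `ω(V)` is an `R`-bimodule exactly if `V` is closed under differentiation: right multiplication
by `x_{e i}` corresponds to the operator `u_{e i} + ∂_{z_i}`. -/
theorem bimodule_iff (V : Submodule (ResField P) (MvPolynomial (Fin c) (ResField P))) :
    (∀ r : MvPolynomial (Fin n) K, ∀ w ∈ V.map (omega P e),
      r • w ∈ V.map (omega P e) ∧ rightAct P e r w ∈ V.map (omega P e)) ↔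
    ∀ i, ∀ G ∈ V, MvPolynomial.pderiv i G ∈ V := by
  have hinj := (omega_injective_and_evalOp_injective P e).1
  constructor
  · intro h i G hG
    have h1 := (h (MvPolynomial.X (e i)) _ (Submodule.mem_map_of_mem hG)).2
    rw [rightAct_omega] at h1
    obtain ⟨H, hH, hHG⟩ := h1
    rw [hinj hHG, gammaHat_apply, gamma_X_self, MvPolynomial.coe_add, diffAct_add,
      LinearMap.add_apply] at hH
    have h2 := V.smul_mem (algebraMap (MvPolynomial (Fin n) K) (ResField P)
      (MvPolynomial.X (e i))) hG
    rwa [diffAct_C, SetLike.mem_coe, V.add_mem_iff_right h2, MvPolynomial.coe_X, diffAct_X] at hH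
  · rintro h r _ ⟨G, hG, rfl⟩
    refine ⟨?_, ?_⟩
    · rw [← algebraMap_smul (ResField P) r (omega P e G)]
      exact Submodule.smul_mem _ _ (Submodule.mem_map_of_mem hG)
    · rw [rightAct_omega]
      exact Submodule.mem_map_of_mem (diffAct_coe_mem h _ hG)

/-- The correspondence between subspaces closed under differentiation and sub-bimodules. -/
theorem weylNoether_correspondence (m : ℕ) :
    Set.BijOn (Submodule.map (omega P e)) (diffClosedSubspaces (ResField P) c m)
        (subBimodules P e m) ∧
      Set.InvOn (Submodule.comap (omega P e)) (Submodule.map (omega P e))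
        (diffClosedSubspaces (ResField P) c m) (subBimodules P e m) := by
  have hinj := (omega_injective_and_evalOp_injective P e).1
  have hsurj := omega_surjective P e
  have hiff : ∀ V, Submodule.map (omega P e) V ∈ subBimodules P e m ↔
      V ∈ diffClosedSubspaces (ResField P) c m := fun V => by
    refine and_congr ?_ (bimodule_iff P e V)
    rw [(Submodule.equivMapOfInjective _ hinj V).finrank_eq]
  have hinv : Set.InvOn (Submodule.comap (omega P e)) (Submodule.map (omega P e))
      (diffClosedSubspaces (ResField P) c m) (subBimodules P e m) :=
    ⟨fun V _ => Submodule.comap_map_eq_of_injective hinj V,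
      fun E _ => Submodule.map_comap_eq_of_surjective hsurj E⟩
  refine ⟨hinv.bijOn (fun V hV => (hiff V).2 hV) fun E hE => ?_, hinv⟩
  rwa [← hiff, Submodule.map_comap_eq_of_surjective hsurj]

/-- Operators lifting a basis of `ω(I^⊥)` send `f` into `P` exactly if `γ(f)` is orthogonal to
`I^⊥`, that is, if `γ(f) ∈ I`. -/
theorem represents_of_isLift {m : ℕ} {I : Ideal (MvPowerSeries (Fin c) (ResField P))}
    {N : ℕ} (hI : Ideal.span (Set.range MvPowerSeries.X) ^ N ≤ I)
    (b : Module.Basis (Fin m) (ResField P) ((inverseSystem I).map (omega P e)))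
    {A : Fin m → RelWeyl K e} (hA : IsLift P e (fun l => (b l : WeylNoether P e)) A) :
    Represents P e A (I.comap (gammaHat P e)) := by
  ext f
  have h1 : ∀ l, RelWeyl.act e (A l) f ∈ P ↔ evalOp P e (b l : WeylNoether P e) f = 0 := by
    intro l
    obtain ⟨s, hs, h⟩ := hA l
    have h2 := congrArg (fun w => evalOp P e w f) h
    simp only [evalOp_tmul, one_mul] at h2
    rw [← algebraMap_resField_eq_zero_iff P, h2, ← algebraMap_smul (ResField P) s, map_smul,
      Pi.smul_apply, smul_eq_mul, mul_eq_zero, algebraMap_resField_eq_zero_iff, or_iff_right hs]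
  have h3 : (∀ l, evalOp P e (b l : WeylNoether P e) f = 0) ↔
      ∀ w ∈ (inverseSystem I).map (omega P e), evalOp P e w f = 0 := by
    refine ⟨fun h w hw => ?_, fun h l => h _ (b l).2⟩
    have hw2 := b.sum_repr ⟨w, hw⟩
    have hw3 := congrArg (fun v : (inverseSystem I).map (omega P e) =>
      evalOp P e (v : WeylNoether P e) f) hw2
    simp only [Submodule.coe_sum, Submodule.coe_smul, map_sum, map_smul, Finset.sum_apply,
      Pi.smul_apply, h, smul_zero, Finset.sum_const_zero] at hw3
    exact hw3.symm
  change gammaHat P e f ∈ I ↔ ∀ l, RelWeyl.act e (A l) f ∈ P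
  simp only [h1]
  rw [h3]
  conv_lhs => rw [← annihilator_inverseSystem hI]
  rw [mem_annihilator_iff fun i G => inverseSystem_pderiv_mem I i]
  simp only [Submodule.mem_map, forall_exists_index, and_imp, forall_apply_eq_imp_iff₂,
    evalOp_omega]

end Evaluation

end DifferentialOperators

/-! ### Height and transcendence degree -/

section Height

/-- Maximal ideals of `k[x_1, …, x_r]` have height `r`. -/
theorem height_eq_of_isMaximal {k : Type*} [Field k] {r : ℕ} (M : Ideal (MvPolynomial (Fin r) k))
    [M.IsMaximal] : M.height = r := by
  induction r with
  | zero =>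
    have h := M.height_le_ringKrullDim_of_ne_top (Ideal.IsMaximal.ne_top ‹_›)
    rw [MvPolynomial.ringKrullDim_of_isNoetherianRing, ringKrullDim_eq_zero_of_field] at h
    simpa using h
  | succ r ih =>
    let ε := (MvPolynomial.finSuccEquiv k r).toRingEquiv
    have : (M.map ε).IsMaximal := Ideal.map_isMaximal_of_equiv ε
    have : ((M.map ε).under (MvPolynomial (Fin r) k)).IsMaximal :=
      Polynomial.isMaximal_comap_C_of_isJacobsonRing (M.map ε)
    have : (M.map ε).LiesOver ((M.map ε).under (MvPolynomial (Fin r) k)) := ⟨rfl⟩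
    rw [← ε.height_map M, Polynomial.height_eq_height_add_one
      ((M.map ε).under (MvPolynomial (Fin r) k)) (M.map ε), ih, Nat.cast_add, Nat.cast_one]

theorem isIntegral_of_surjective_mvPolynomial {k A σ : Type*} [CommRing k] [CommRing A]
    [Algebra k A]
    (g : MvPolynomial σ k →ₐ[k] A) (hg : Function.Surjective g)
    (hX : ∀ i, IsIntegral k (g (MvPolynomial.X i))) : Algebra.IsIntegral k A := by
  constructor
  intro q
  obtain ⟨q, rfl⟩ := hg q
  induction q using MvPolynomial.induction_on with
  | C a =>
    rw [← MvPolynomial.algebraMap_eq, AlgHom.commutes]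
    exact isIntegral_algebraMap
  | add p q hp hq => rw [map_add]; exact hp.add hq
  | mul_X p i hp => rw [map_mul]; exact hp.mul (hX i)

/-- A prime of `k[x_1, …, x_r]` modulo which all variables are algebraic over `k` is maximal. -/
theorem isMaximal_of_isAlgebraic_variables {k : Type*} [Field k] {r : ℕ}
    (P : Ideal (MvPolynomial (Fin r) k)) [P.IsPrime]
    (hX : ∀ i, ∃ p : Polynomial k, p ≠ 0 ∧ p.eval₂ MvPolynomial.C (MvPolynomial.X i) ∈ P) :
    P.IsMaximal := by
  have hint : Algebra.IsIntegral k (MvPolynomial (Fin r) k ⧸ P) := by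
    refine isIntegral_of_surjective_mvPolynomial (Ideal.Quotient.mkₐ k P)
      (Ideal.Quotient.mkₐ_surjective k P) fun i => ?_
    obtain ⟨p, hp0, hp⟩ := hX i
    rw [← isAlgebraic_iff_isIntegral]
    refine ⟨p, hp0, ?_⟩
    rw [Polynomial.aeval_algHom_apply, Ideal.Quotient.mkₐ_eq_mk, Ideal.Quotient.eq_zero_iff_mem]
    exact hp
  exact Ideal.Quotient.maximal_of_isField _
    (isField_of_isIntegral_of_isField' (Field.toIsField k))

attribute [local instance] MvPolynomial.algebraMvPolynomial in
/-- A prime of `B[x_1, …, x_r]` that meets `B` in `0` and modulo which all variables are algebraic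
over `B` has height `r`. -/
theorem height_eq_of_isAlgebraic {B : Type*} [CommRing B] [IsDomain B] {r : ℕ}
    (P : Ideal (MvPolynomial (Fin r) B)) [P.IsPrime]
    (hB : ∀ b, MvPolynomial.C b ∈ P → b = 0)
    (hX : ∀ i, ∃ p : Polynomial B, p ≠ 0 ∧ p.eval₂ MvPolynomial.C (MvPolynomial.X i) ∈ P) :
    P.height = r := by
  let k := FractionRing B
  let M := (nonZeroDivisors B).map (MvPolynomial.C (σ := Fin r))
  have hloc : IsLocalization M (MvPolynomial (Fin r) k) :=
    MvPolynomial.isLocalization (nonZeroDivisors B) k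
  have hdisj : Disjoint (M : Set (MvPolynomial (Fin r) B)) P := by
    refine Set.disjoint_left.2 ?_
    rintro _ ⟨b, hb, rfl⟩ hbP
    exact nonZeroDivisors.ne_zero hb (hB b hbP)
  rw [← IsLocalization.height_map_of_disjoint (S := MvPolynomial (Fin r) k) M P hdisj]
  have : (P.map (algebraMap (MvPolynomial (Fin r) B) (MvPolynomial (Fin r) k))).IsPrime :=
    IsLocalization.isPrime_of_isPrime_disjoint M _ P ‹_› hdisj
  have : (P.map (algebraMap (MvPolynomial (Fin r) B) (MvPolynomial (Fin r) k))).IsMaximal := by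
    refine isMaximal_of_isAlgebraic_variables _ fun i => ?_
    obtain ⟨p, hp0, hp⟩ := hX i
    refine ⟨p.map (algebraMap B k), ?_, ?_⟩
    · rwa [Ne, Polynomial.map_eq_zero_iff (IsFractionRing.injective B k)]
    · have h1 := Ideal.mem_map_of_mem
        (algebraMap (MvPolynomial (Fin r) B) (MvPolynomial (Fin r) k)) hp
      rw [Polynomial.hom_eval₂, MvPolynomial.algebraMap_def, MvPolynomial.map_X] at h1
      have hC : (MvPolynomial.map (algebraMap B k)).comp MvPolynomial.C =
          (MvPolynomial.C (σ := Fin r)).comp (algebraMap B k) :=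
        RingHom.ext fun b => MvPolynomial.map_C _ b
      rw [Polynomial.eval₂_map, ← hC]
      exact h1
  exact height_eq_of_isMaximal _

/-- Algebraicity over a transcendence basis `x`, with coefficients in the polynomial ring instead of
the subalgebra generated by `x`. -/
theorem exists_eval₂_aeval_eq_zero {k A ι : Type*} [Field k] [Field A] [Algebra k A] {x : ι → A}
    (hx : IsTranscendenceBasis k x) (a : A) : ∃ p : Polynomial (MvPolynomial ι k), p ≠ 0 ∧
      p.eval₂ (MvPolynomial.aeval x : MvPolynomial ι k →ₐ[k] A).toRingHom a = 0 := by
  obtain ⟨p, hp0, hp⟩ := hx.isAlgebraic.1 a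
  refine ⟨p.map (hx.1.aevalEquiv.symm : _ →ₐ[k] MvPolynomial ι k).toRingHom, ?_, ?_⟩
  · rwa [Ne, Polynomial.map_eq_zero_iff hx.1.aevalEquiv.symm.injective]
  · rw [Polynomial.eval₂_map]
    rw [Polynomial.aeval_def] at hp
    refine Eq.trans (congrArg (fun f => p.eval₂ f a) ?_) hp
    refine RingHom.ext fun q => ?_
    have := hx.1.algebraMap_aevalEquiv (hx.1.aevalEquiv.symm q)
    rw [AlgEquiv.apply_symm_apply] at this
    exact this.symm

variable {K : Type*} [Field K] {n c : ℕ} (P : Ideal (MvPolynomial (Fin n) K))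

/-- The residue class `u_j ∈ F` of the variable `x_j`. -/
def varClass (j : Fin n) : ResField P :=
  algebraMap (MvPolynomial (Fin n) K) (ResField P) (MvPolynomial.X j)

theorem aeval_varClass {ι : Type*} (g : ι → Fin n) (p : MvPolynomial ι K) :
    MvPolynomial.aeval (fun i => varClass P (g i)) p =
      algebraMap (MvPolynomial (Fin n) K) (ResField P) (MvPolynomial.rename g p) := by
  have h : MvPolynomial.aeval (fun i => varClass P (g i)) =
      (IsScalarTower.toAlgHom K (MvPolynomial (Fin n) K) (ResField P)).comp
        (MvPolynomial.rename g) := by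
    refine MvPolynomial.algHom_ext fun i => ?_
    simp [varClass]
  rw [h]
  rfl

variable [P.IsPrime]

/-- If the classes of `n - r` of the variables form a transcendence basis of `F` over `K`, then
`P` has height `r`: inverting the nonzero polynomials in these variables turns `P` into a maximal
ideal in the remaining `r` variables. -/
theorem height_eq_of_isTranscendenceBasis {ι : Type*} {r : ℕ} (ε : Fin r ⊕ ι ≃ Fin n)
    (hx : IsTranscendenceBasis K fun i : ι => varClass P (ε (Sum.inr i))) : P.height = r := by
  let Ψ : MvPolynomial (Fin n) K ≃ₐ[K] MvPolynomial (Fin r) (MvPolynomial ι K) :=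
    (MvPolynomial.renameEquiv K ε.symm).trans (MvPolynomial.sumAlgEquiv K (Fin r) ι)
  have hC : ∀ p, Ψ.symm (MvPolynomial.C p) =
      MvPolynomial.rename (fun i => ε (Sum.inr i)) p := by
    intro p
    rw [AlgEquiv.symm_apply_eq]
    induction p using MvPolynomial.induction_on with
    | C a => simp [Ψ]
    | add p q hp hq => rw [map_add, map_add, map_add, hp, hq]
    | mul_X p i hp =>
      rw [map_mul, map_mul, map_mul, hp, MvPolynomial.rename_X]
      simp [Ψ]
  have hX : ∀ i, Ψ.symm (MvPolynomial.X i) = MvPolynomial.X (ε (Sum.inl i)) := by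
    intro i
    rw [AlgEquiv.symm_apply_eq]
    simp [Ψ]
  have hmem : ∀ q, q ∈ P.comap Ψ.symm.toRingEquiv ↔
      algebraMap (MvPolynomial (Fin n) K) (ResField P) (Ψ.symm q) = 0 :=
    fun q => (algebraMap_resField_eq_zero_iff P _).symm
  rw [← Ψ.symm.toRingEquiv.height_comap P]
  have : (P.comap Ψ.symm.toRingEquiv).IsPrime := Ideal.comap_isPrime _ _
  refine height_eq_of_isAlgebraic _ (fun b hb => ?_) fun i => ?_
  · rw [hmem, hC, ← aeval_varClass] at hb
    exact hx.1 (hb.trans (map_zero _).symm)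
  · obtain ⟨p, hp0, hp⟩ := exists_eval₂_aeval_eq_zero hx (varClass P (ε (Sum.inl i)))
    refine ⟨p, hp0, ?_⟩
    rw [hmem, ← hp, varClass, ← hX]
    change ((algebraMap (MvPolynomial (Fin n) K) (ResField P)).comp Ψ.symm.toRingEquiv.toRingHom) _
      = _
    rw [Polynomial.hom_eval₂]
    congr 1
    refine RingHom.ext fun q => ?_
    refine Eq.trans ?_ (aeval_varClass P (fun i => ε (Sum.inr i)) q).symm
    exact congrArg (algebraMap (MvPolynomial (Fin n) K) (ResField P)) (hC q)

/-- Independence modulo `P` is algebraic independence in `F`. The index type `ι` of the remaining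
variables is arbitrary. -/
theorem complementIndependent_iff {ι : Type*} {e : Fin c ↪ Fin n} {g : ι → Fin n}
    (hg : Function.Injective g) (hr : Set.range g = (Set.range e)ᶜ) :
    ComplementIndependent P e ↔ AlgebraicIndependent K fun i => varClass P (g i) := by
  rw [algebraicIndependent_iff]
  constructor
  · intro h p hp
    rw [aeval_varClass, algebraMap_resField_eq_zero_iff] at hp
    refine MvPolynomial.rename_injective g hg ((h _ hp ?_).trans (map_zero _).symm)
    classical
    rw [MvPolynomial.mem_supported, ← hr]
    refine (Finset.coe_subset.2 (MvPolynomial.vars_rename g p)).trans ?_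
    simp
  · intro h f hf hs
    rw [← hr] at hs
    have hs' : f ∈ (MvPolynomial.rename (R := K) g).range := by
      rw [MvPolynomial.supported_eq_adjoin_X, ← Set.range_comp,
        Algebra.adjoin_range_eq_range_aeval] at hs
      have h1 : MvPolynomial.aeval (MvPolynomial.X ∘ g) = MvPolynomial.rename (R := K) g :=
        MvPolynomial.algHom_ext fun i => by simp
      rwa [h1] at hs
    obtain ⟨p, rfl⟩ := hs'
    rw [h p, map_zero]
    rw [aeval_varClass]
    exact (algebraMap_resField_eq_zero_iff P _).2 hf

theorem adjoin_varClass_isAlgebraic :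
    Algebra.IsAlgebraic (Algebra.adjoin K (Set.range (varClass P))) (ResField P) := by
  have hmem : ∀ f : MvPolynomial (Fin n) K, IsAlgebraic
      (Algebra.adjoin K (Set.range (varClass P)))
      (algebraMap (MvPolynomial (Fin n) K) (ResField P) f) := by
    intro f
    have h := aeval_varClass P (fun j => j) f
    rw [show MvPolynomial.rename (fun j : Fin n => j) f = f from MvPolynomial.rename_id_apply f]
      at h
    have h2 : algebraMap (MvPolynomial (Fin n) K) (ResField P) f ∈
        Algebra.adjoin K (Set.range (varClass P)) := by
      rw [Algebra.adjoin_range_eq_range_aeval, ← h]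
      exact ⟨f, rfl⟩
    exact isAlgebraic_algebraMap
      (⟨_, h2⟩ : Algebra.adjoin K (Set.range (varClass P)))
  constructor
  intro a
  obtain ⟨s, hs, r, hr⟩ := exists_smul_eq_algebraMap P a
  rw [← algebraMap_resField_eq_zero_iff] at hs
  have ha : a = (algebraMap (MvPolynomial (Fin n) K) (ResField P) s)⁻¹ *
      algebraMap (MvPolynomial (Fin n) K) (ResField P) r := by
    rw [← hr, Algebra.smul_def, inv_mul_cancel_left₀ hs]
  rw [ha]
  exact (hmem s).inv.mul (hmem r)

/-- Some `n - height P` of the variables are a transcendence basis modulo `P`. -/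
theorem exists_isTranscendenceBasis_varClass (hP : P.height = c) :
    ∃ (ι : Type) (ε : Fin c ⊕ ι ≃ Fin n),
      IsTranscendenceBasis K fun i : ι => varClass P (ε (Sum.inr i)) := by
  classical
  have := adjoin_varClass_isAlgebraic P
  obtain ⟨t, ht, hb⟩ := exists_isTranscendenceBasis_subset (R := K) (Set.range (varClass P))
  choose g hg using fun y : t => ht y.2
  have hginj : Function.Injective g := fun y z h => Subtype.ext (by rw [← hg, ← hg, h])
  let s := Set.range g
  let ε : Fin (Fintype.card ↥sᶜ) ⊕ s ≃ Fin n :=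
    ((Fintype.equivFin ↥sᶜ).symm.sumCongr (Equiv.refl s)).trans
      ((Equiv.sumComm _ _).trans (Equiv.Set.sumCompl s))
  have hε : IsTranscendenceBasis K fun i : s => varClass P (ε (Sum.inr i)) := by
    rw [← isTranscendenceBasis_equiv (Equiv.ofInjective g hginj)]
    convert hb using 1
    funext y
    exact hg y
  have hr : Fintype.card ↥sᶜ = c := by
    have := height_eq_of_isTranscendenceBasis P ε hε
    rw [hP] at this
    exact_mod_cast this.symm
  subst hr
  exact ⟨s, ε, hε⟩

theorem exists_complementIndependent (hP : P.height = c) :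
    ∃ e : Fin c ↪ Fin n, ComplementIndependent P e := by
  obtain ⟨ι, ε, hε⟩ := exists_isTranscendenceBasis_varClass P hP
  refine ⟨⟨fun i => ε (Sum.inl i), ε.injective.comp Sum.inl_injective⟩,
    (complementIndependent_iff P (g := fun i => ε (Sum.inr i))
      (ε.injective.comp Sum.inr_injective) ?_).2 hε.1⟩
  ext j
  obtain ⟨i | i, rfl⟩ := ε.surjective j <;> simp

/-- If `P` has height `c`, any `n - c` variables independent modulo `P` form a transcendence basis
of `F` over `K`. -/
theorem isTranscendenceBasis_of_complementIndependent (hP : P.height = c) {e : Fin c ↪ Fin n}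
    (he : ComplementIndependent P e) :
    IsTranscendenceBasis K fun j : ↥(Set.range e)ᶜ => varClass P j := by
  classical
  obtain ⟨ι, ε, hε⟩ := exists_isTranscendenceBasis_varClass P hP
  have : Finite ι := Finite.of_injective _ (ε.injective.comp Sum.inr_injective)
  have := Fintype.ofFinite ι
  have hcard : Fintype.card ↥(Set.range e)ᶜ = Fintype.card ι := by
    have h1 := Fintype.card_congr ε
    rw [Fintype.card_sum, Fintype.card_fin, Fintype.card_fin] at h1
    rw [Fintype.card_compl_set, Set.card_range_of_injective e.injective, Fintype.card_fin,
      Fintype.card_fin]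
    omega
  refine AlgebraicIndependent.isTranscendenceBasis_of_lift_trdeg_le_of_finite
    ((complementIndependent_iff P Subtype.val_injective Subtype.range_val).1 he) ?_
  rw [← hε.lift_cardinalMk_eq_trdeg]
  simp [hcard]

end Height

/-! ### Lifting the residue field -/

section Lifting

/-- In characteristic `0` a field is formally étale over a polynomial ring in a transcendence basis:
it is separable algebraic over the fraction field, which is a localization. -/
theorem formallyEtale_of_isTranscendenceBasis {K F ι : Type*} [Field K] [CharZero K] [Field F]
    [Algebra K F] [Algebra (MvPolynomial ι K) F] [IsScalarTower K (MvPolynomial ι K) F]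
    (hx : IsTranscendenceBasis K fun i : ι => algebraMap (MvPolynomial ι K) F (MvPolynomial.X i)) :
    Algebra.FormallyEtale (MvPolynomial ι K) F := by
  have haeval : (MvPolynomial.aeval fun i : ι =>
      algebraMap (MvPolynomial ι K) F (MvPolynomial.X i)) =
      IsScalarTower.toAlgHom K (MvPolynomial ι K) F :=
    MvPolynomial.algHom_ext fun i => by simp
  have hinj : Function.Injective (algebraMap (MvPolynomial ι K) F) := by
    have h := hx.1
    rw [AlgebraicIndependent, haeval] at h
    exact h
  have : FaithfulSMul (MvPolynomial ι K) F := (faithfulSMul_iff_algebraMap_injective _ _).2 hinj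
  let : Algebra (FractionRing (MvPolynomial ι K)) F := FractionRing.liftAlgebra _ F
  have : IsScalarTower (MvPolynomial ι K) (FractionRing (MvPolynomial ι K)) F :=
    FractionRing.isScalarTower_liftAlgebra _ F
  have halg : Algebra.IsAlgebraic (MvPolynomial ι K) F := by
    constructor
    intro a
    obtain ⟨p, hp0, hp⟩ := exists_eval₂_aeval_eq_zero hx a
    rw [haeval] at hp
    exact ⟨p, hp0, hp⟩
  have : Algebra.IsAlgebraic (FractionRing (MvPolynomial ι K)) F :=
    (IsFractionRing.comap_isAlgebraic_iff (A := MvPolynomial ι K)).1 halg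
  have : CharZero (FractionRing (MvPolynomial ι K)) :=
    charZero_of_injective_algebraMap (algebraMap K _).injective
  have : Algebra.FormallyEtale (MvPolynomial ι K) (FractionRing (MvPolynomial ι K)) :=
    Algebra.FormallyEtale.of_isLocalization (nonZeroDivisors _)
  have : Algebra.FormallyEtale (FractionRing (MvPolynomial ι K)) F :=
    Algebra.FormallyEtale.of_isSeparable _ _
  exact Algebra.FormallyEtale.comp _ (FractionRing (MvPolynomial ι K)) F

theorem ringHom_eq_of_adjoin {B R C : Type*} [CommRing B] [CommRing R] [Algebra B R] [Semiring C]
    {s : Set R} (hs : Algebra.adjoin B s = ⊤) (f f' : R →+* C)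
    (hB : ∀ b, f (algebraMap B R b) = f' (algebraMap B R b)) (h : ∀ x ∈ s, f x = f' x) (r : R) :
    f r = f' r := by
  have hr : r ∈ Algebra.adjoin B s := hs ▸ Algebra.mem_top
  induction hr using Algebra.adjoin_induction with
  | mem r hr => exact h r hr
  | algebraMap b => exact hB b
  | add r t _ _ hr ht => rw [map_add, map_add, hr, ht]
  | mul r t _ _ hr ht => rw [map_mul, map_mul, hr, ht]

/-- Comparison of a nilpotent thickening `A` of the field `F` with the quotients of `F[[y]]`.
Let `R = B[v_1, …, v_c]` with `F` formally étale over `B`, let `γ : R → F[[y]]` be the Taylor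
expansion `v_i ↦ u_i + y_i`, and let `A` be a nilpotent thickening of `F` all of whose elements are
fractions from `R`. Lifting `F` to `A` gives `ψ : F[[y]] → A` with `ψ(u_i) = σ(u_i)` and
`ψ(y_i) = v_i - σ(u_i)` for the lift `σ`, hence `ψ ∘ γ` is the given map `R → A`. If `γ` induces
`g : A → F[[y]]/I`, then `g ∘ ψ` is the projection, because `g ∘ σ` and the inclusion of constants
are two lifts of `F` to `F[[y]]/I` over `B`. -/
theorem exists_surjective_of_formallyEtale {B F R A : Type*} [CommRing B] [Field F] [CommRing R]
    [CommRing A] [Algebra B F] [Algebra.FormallyEtale B F] [Algebra B R] [Algebra R F]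
    [IsScalarTower B R F] {c : ℕ} {v : Fin c → R} (hv : Algebra.adjoin B (Set.range v) = ⊤)
    {γ : R →+* MvPowerSeries (Fin c) F}
    (hγB : ∀ b, γ (algebraMap B R b) = MvPowerSeries.C (algebraMap B F b))
    (hγv : ∀ i, γ (v i) = MvPowerSeries.C (algebraMap R F (v i)) + MvPowerSeries.X i)
    {φ : R →+* A} {ρ : A →+* F} (hρφ : ∀ r, ρ (φ r) = algebraMap R F r)
    (hρ : Function.Surjective ρ) (hnil : IsNilpotent (RingHom.ker ρ))
    (hφ : ∀ a, ∃ r s, IsUnit (φ s) ∧ a * φ s = φ r)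
    {I : Ideal (MvPowerSeries (Fin c) F)} {N : ℕ}
    (hI : Ideal.span (Set.range MvPowerSeries.X) ^ N ≤ I)
    (hI' : I ≤ IsLocalRing.maximalIdeal (MvPowerSeries (Fin c) F))
    {g : A →+* MvPowerSeries (Fin c) F ⧸ I} (hg : ∀ r, g (φ r) = Ideal.Quotient.mk I (γ r)) :
    ∃ ψ : MvPowerSeries (Fin c) F →+* A, Function.Surjective ψ ∧ (∀ r, ψ (γ r) = φ r) ∧
      ∀ f, g (ψ f) = Ideal.Quotient.mk I f := by
  have hγ0 : ∀ r, MvPowerSeries.constantCoeff (γ r) = algebraMap R F r := by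
    refine ringHom_eq_of_adjoin hv (MvPowerSeries.constantCoeff.comp γ) (algebraMap R F) (fun b => ?_)
      (Set.forall_mem_range.2 fun i => ?_)
    · rw [RingHom.comp_apply, hγB, MvPowerSeries.constantCoeff_C,
        ← IsScalarTower.algebraMap_apply]
    · rw [RingHom.comp_apply, hγv, map_add, MvPowerSeries.constantCoeff_C,
        MvPowerSeries.constantCoeff_X, add_zero]
  -- the lift `σ : F → A` of the residue field and the evaluation `ψ`
  let : Algebra B A := (φ.comp (algebraMap B R)).toAlgebra
  let ρ' : A →ₐ[B] F := { ρ with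
    commutes' := fun b => (hρφ _).trans (IsScalarTower.algebraMap_apply B R F b).symm }
  let σ : F →ₐ[B] A := Algebra.FormallySmooth.liftOfSurjective (AlgHom.id B F) ρ' hρ hnil
  have hσ : ∀ a, ρ (σ a) = a := fun a =>
    Algebra.FormallySmooth.liftOfSurjective_apply (AlgHom.id B F) ρ' hρ hnil a
  obtain ⟨ψ, hψ⟩ := exists_eval_of_nilpotent σ.toRingHom
    (fun i => φ (v i) - σ (algebraMap R F (v i))) fun i => by
      obtain ⟨k, hk⟩ := hnil
      refine ⟨k, ?_⟩
      have : (φ (v i) - σ (algebraMap R F (v i))) ^ k ∈ RingHom.ker ρ ^ k :=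
        Ideal.pow_mem_pow (by rw [RingHom.mem_ker, map_sub, hρφ, hσ, sub_self]) k
      rwa [hk] at this
  have hψC : ∀ a, ψ (MvPowerSeries.C a) = σ a := fun a => by
    rw [← MvPolynomial.coe_C, hψ, MvPolynomial.eval₂_C]
    rfl
  have hψX : ∀ i, ψ (MvPowerSeries.X i) = φ (v i) - σ (algebraMap R F (v i)) := fun i => by
    rw [← MvPolynomial.coe_X, hψ, MvPolynomial.eval₂_X]
  have hψγ : ∀ r, ψ (γ r) = φ r := by
    refine ringHom_eq_of_adjoin hv (ψ.comp γ) φ (fun b => ?_)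
      (Set.forall_mem_range.2 fun i => ?_)
    · rw [RingHom.comp_apply, hγB, hψC, AlgHom.commutes]
      rfl
    · rw [RingHom.comp_apply, hγv, map_add, hψC, hψX, add_sub_cancel]
  refine ⟨ψ, fun a => ?_, hψγ, ?_⟩
  · obtain ⟨r, s, hs, hrs⟩ := hφ a
    have hu : IsUnit (γ s) := by
      rw [MvPowerSeries.isUnit_iff_constantCoeff, hγ0, ← hρφ]
      exact hs.map ρ
    obtain ⟨t, ht⟩ := hu.exists_right_inv
    refine ⟨γ r * t, ?_⟩
    rw [map_mul, hψγ, ← hrs, ← hψγ s, mul_assoc, ← map_mul, ht, map_one, mul_one]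
  · -- the residue map of `F[[y]]/I`
    let res : MvPowerSeries (Fin c) F ⧸ I →+* F :=
      Ideal.Quotient.lift I MvPowerSeries.constantCoeff fun f hf =>
        (mem_maximalIdeal_iff f).1 (hI' hf)
    have hres : ∀ f, res (Ideal.Quotient.mk I f) = MvPowerSeries.constantCoeff f :=
      fun f => Ideal.Quotient.lift_mk I _ _
    have hresnil : IsNilpotent (RingHom.ker res) := by
      refine ⟨N, ?_⟩
      have hle : RingHom.ker res ≤ (Ideal.span (Set.range (MvPowerSeries.X :
          Fin c → MvPowerSeries (Fin c) F))).map (Ideal.Quotient.mk I) := by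
        intro f hf
        obtain ⟨f, rfl⟩ := Ideal.Quotient.mk_surjective f
        rw [RingHom.mem_ker, hres, ← mem_maximalIdeal_iff, ← span_X_eq_maximalIdeal] at hf
        exact Ideal.mem_map_of_mem _ hf
      rw [Ideal.zero_eq_bot, eq_bot_iff]
      refine (Ideal.pow_right_mono hle N).trans ?_
      rw [← Ideal.map_pow, Ideal.map_le_iff_le_comap]
      intro f hf
      exact Ideal.Quotient.eq_zero_iff_mem.2 (hI hf)
    have hresg : ∀ a, res (g a) = ρ a := by
      intro a
      obtain ⟨r, s, hs, hrs⟩ := hφ a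
      have h0 : ∀ r, res (g (φ r)) = ρ (φ r) := fun r => by rw [hg, hres, hγ0, hρφ]
      have h1 := congrArg (fun x => res (g x)) hrs
      have h2 := congrArg ρ hrs
      simp only [map_mul, h0] at h1 h2
      exact (hs.map ρ).mul_right_cancel (h1.trans h2.symm)
    let : Algebra B (MvPowerSeries (Fin c) F ⧸ I) :=
      (((Ideal.Quotient.mk I).comp MvPowerSeries.C).comp (algebraMap B F)).toAlgebra
    let g₁ : F →ₐ[B] MvPowerSeries (Fin c) F ⧸ I :=
      { (g.comp σ.toRingHom) with
        commutes' := fun b => by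
          change g (σ (algebraMap B F b)) = Ideal.Quotient.mk I (MvPowerSeries.C (algebraMap B F b))
          rw [AlgHom.commutes, ← hγB]
          exact hg _ }
    let g₂ : F →ₐ[B] MvPowerSeries (Fin c) F ⧸ I :=
      { ((Ideal.Quotient.mk I).comp MvPowerSeries.C) with commutes' := fun b => rfl }
    have hgg : g₁ = g₂ := by
      refine Algebra.FormallyUnramified.ext' res hresnil g₁ g₂ fun a => ?_
      change res (g (σ a)) = res (Ideal.Quotient.mk I (MvPowerSeries.C a))
      rw [hresg, hσ, hres, MvPowerSeries.constantCoeff_C]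
    have hgσ : ∀ a, g (σ a) = Ideal.Quotient.mk I (MvPowerSeries.C a) :=
      fun a => congrArg (fun h => h a) hgg
    have hX : ∀ i, g (ψ (MvPowerSeries.X i)) = Ideal.Quotient.mk I (MvPowerSeries.X i) := by
      intro i
      rw [hψX, map_sub, hg, hγv, hgσ, map_add, add_sub_cancel_left]
    have hker : Ideal.span (Set.range MvPowerSeries.X) ^ N ≤ RingHom.ker (g.comp ψ) := by
      rw [RingHom.ker_eq_comap_bot, ← Ideal.map_le_iff_le_comap, Ideal.map_pow, Ideal.map_span,
        ← Set.range_comp]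
      have : (g.comp ψ) ∘ MvPowerSeries.X = Ideal.Quotient.mk I ∘ MvPowerSeries.X := funext hX
      rw [this, Set.range_comp, ← Ideal.map_span, ← Ideal.map_pow, Ideal.map_le_iff_le_comap]
      intro f hf
      exact Ideal.Quotient.eq_zero_iff_mem.2 (hI hf)
    have := ringHom_ext_of_pow (f := g.comp ψ) (g := Ideal.Quotient.mk I) hker
      (by rw [Ideal.mk_ker]; exact hI) (fun a => by rw [RingHom.comp_apply, hψC, hgσ]) hX
    exact fun f => congrArg (fun h => h f) this

end Lifting

/-! ### Primary ideals and ideals of finite colength -/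

section Primary

variable {K : Type*} [Field K] {n c : ℕ} (P : Ideal (MvPolynomial (Fin n) K)) [P.IsPrime]
  (e : Fin c ↪ Fin n)

/-- The local ring `R_P / Q R_P`. -/
def LocalQuot (Q : Ideal (MvPolynomial (Fin n) K)) : Type _ :=
  Localization.AtPrime P ⧸ Q.map (algebraMap (MvPolynomial (Fin n) K) (Localization.AtPrime P))

instance (Q : Ideal (MvPolynomial (Fin n) K)) : CommRing (LocalQuot P Q) :=
  inferInstanceAs (CommRing (Localization.AtPrime P ⧸
    Q.map (algebraMap (MvPolynomial (Fin n) K) (Localization.AtPrime P))))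

/-- The projection `R_P → R_P / Q R_P`. -/
def localQuotMk (Q : Ideal (MvPolynomial (Fin n) K)) : Localization.AtPrime P →+* LocalQuot P Q :=
  Ideal.Quotient.mk (Q.map (algebraMap (MvPolynomial (Fin n) K) (Localization.AtPrime P)))

/-- The canonical map `R → R_P / Q R_P`. -/
def toLocalQuot (Q : Ideal (MvPolynomial (Fin n) K)) : MvPolynomial (Fin n) K →+* LocalQuot P Q :=
  (localQuotMk P Q).comp (algebraMap (MvPolynomial (Fin n) K) (Localization.AtPrime P))

/-- The extension to `R_P / Q R_P` of a ring homomorphism on `R` that kills `Q` and inverts the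
complement of `P`. -/
def liftLocalQuot {Q : Ideal (MvPolynomial (Fin n) K)} {C : Type*} [CommRing C]
    (f : MvPolynomial (Fin n) K →+* C) (hQ : ∀ q ∈ Q, f q = 0) (hP : ∀ s ∉ P, IsUnit (f s)) :
    LocalQuot P Q →+* C :=
  Ideal.Quotient.lift _ (IsLocalization.lift (M := P.primeCompl) (g := f) fun s => hP s s.2) (by
    change Q.map _ ≤ RingHom.ker _
    rw [Ideal.map_le_iff_le_comap]
    intro q hq
    rw [Ideal.mem_comap, RingHom.mem_ker, IsLocalization.lift_eq]
    exact hQ q hq)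

theorem liftLocalQuot_apply {Q : Ideal (MvPolynomial (Fin n) K)} {C : Type*} [CommRing C]
    (f : MvPolynomial (Fin n) K →+* C) (hQ : ∀ q ∈ Q, f q = 0) (hP : ∀ s ∉ P, IsUnit (f s))
    (r : MvPolynomial (Fin n) K) :
    liftLocalQuot P f hQ hP (toLocalQuot P Q r) = f r := by
  rw [toLocalQuot, RingHom.comp_apply]
  exact IsLocalization.lift_eq _ r

theorem isUnit_toLocalQuot (Q : Ideal (MvPolynomial (Fin n) K)) {s : MvPolynomial (Fin n) K}
    (hs : s ∉ P) : IsUnit (toLocalQuot P Q s) :=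
  (IsLocalization.map_units (Localization.AtPrime P) (⟨s, hs⟩ : P.primeCompl)).map
    (localQuotMk P Q)

theorem exists_mul_toLocalQuot_eq (Q : Ideal (MvPolynomial (Fin n) K)) (a : LocalQuot P Q) :
    ∃ r, ∃ s ∉ P, a * toLocalQuot P Q s = toLocalQuot P Q r := by
  obtain ⟨a, rfl⟩ : ∃ x, localQuotMk P Q x = a := Ideal.Quotient.mk_surjective a
  obtain ⟨⟨r, s⟩, h⟩ := IsLocalization.surj P.primeCompl a
  refine ⟨r, s, s.2, ?_⟩
  rw [toLocalQuot, RingHom.comp_apply, RingHom.comp_apply, ← map_mul, h]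

/-- A `P`-primary ideal is contracted from `R_P`. -/
theorem toLocalQuot_eq_zero_iff {Q : Ideal (MvPolynomial (Fin n) K)} (hQ : Q.IsPrimary)
    (hQP : Q.radical = P) (r : MvPolynomial (Fin n) K) : toLocalQuot P Q r = 0 ↔ r ∈ Q := by
  have hdisj : Disjoint (P.primeCompl : Set (MvPolynomial (Fin n) K)) Q :=
    Set.disjoint_left.2 fun s hs hsQ => hs (hQP ▸ Ideal.le_radical hsQ)
  have h := IsLocalization.under_map_of_isPrimary_disjoint P.primeCompl (Localization.AtPrime P)
    hQ hdisj
  conv_rhs => rw [← h]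
  exact Ideal.Quotient.eq_zero_iff_mem

theorem constantCoeff_gammaHat (f : MvPolynomial (Fin n) K) :
    MvPowerSeries.constantCoeff (gammaHat P e f) =
      algebraMap (MvPolynomial (Fin n) K) (ResField P) f := by
  rw [← constantCoeff_gamma P e, gammaHat_apply, ← MvPowerSeries.coeff_zero_eq_constantCoeff_apply,
    MvPolynomial.coeff_coe, MvPolynomial.constantCoeff_eq]

theorem gammaHat_mem_maximalIdeal_iff (f : MvPolynomial (Fin n) K) :
    gammaHat P e f ∈ IsLocalRing.maximalIdeal (MvPowerSeries (Fin c) (ResField P)) ↔ f ∈ P := by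
  rw [mem_maximalIdeal_iff, constantCoeff_gammaHat, algebraMap_resField_eq_zero_iff]

theorem isUnit_gammaHat {s : MvPolynomial (Fin n) K} (hs : s ∉ P) : IsUnit (gammaHat P e s) := by
  rw [← gammaHat_mem_maximalIdeal_iff P e] at hs
  rwa [IsLocalRing.mem_maximalIdeal, mem_nonunits_iff, not_not] at hs

theorem gamma_rename (b : MvPolynomial ↥(Set.range e)ᶜ K) :
    gamma P e (MvPolynomial.rename Subtype.val b) = MvPolynomial.C
      (algebraMap (MvPolynomial (Fin n) K) (ResField P) (MvPolynomial.rename Subtype.val b)) := by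
  induction b using MvPolynomial.induction_on with
  | C a => rw [MvPolynomial.rename_C, gamma_C]
  | add p q hp hq => simp only [map_add, hp, hq]
  | mul_X p j hp =>
    simp only [map_mul, hp, MvPolynomial.rename_X]
    rw [gamma_X_of_notMem P e j.2]

/-- The residue map of `R_P / Q R_P` onto `F`; its kernel is nilpotent because `P` is the radical
of the finitely generated ideal `Q`. -/
theorem exists_residue {Q : Ideal (MvPolynomial (Fin n) K)} (hQP : Q.radical = P) :
    ∃ ρ : LocalQuot P Q →+* ResField P,
      (∀ r, ρ (toLocalQuot P Q r) = algebraMap (MvPolynomial (Fin n) K) (ResField P) r) ∧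
      Function.Surjective ρ ∧ IsNilpotent (RingHom.ker ρ) := by
  have hQ : Q ≤ P := hQP ▸ Ideal.le_radical
  have hunit : ∀ s ∉ P, IsUnit (algebraMap (MvPolynomial (Fin n) K) (ResField P) s) :=
    fun s hs => isUnit_iff_ne_zero.2 fun h => hs ((algebraMap_resField_eq_zero_iff P s).1 h)
  let ρ : LocalQuot P Q →+* ResField P := liftLocalQuot P
    (algebraMap (MvPolynomial (Fin n) K) (ResField P))
    (fun q hq => (algebraMap_resField_eq_zero_iff P q).2 (hQ hq)) hunit
  have hρ : ∀ r, ρ (toLocalQuot P Q r) = algebraMap (MvPolynomial (Fin n) K) (ResField P) r :=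
    liftLocalQuot_apply P _ _ _
  refine ⟨ρ, hρ, fun a => ?_, ?_⟩
  · obtain ⟨s, hs, r, hr⟩ := exists_smul_eq_algebraMap P a
    obtain ⟨t, ht⟩ := (isUnit_toLocalQuot P Q hs).exists_right_inv
    refine ⟨toLocalQuot P Q r * t, (hunit s hs).mul_left_cancel ?_⟩
    rw [Algebra.smul_def] at hr
    rw [hr, ← hρ, ← hρ, ← map_mul, mul_left_comm, ht, mul_one]
  · obtain ⟨N, hN⟩ := Ideal.exists_radical_pow_le_of_fg Q
      (IsNoetherian.noetherian Q.radical)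
    rw [hQP] at hN
    refine ⟨N, ?_⟩
    have hle : RingHom.ker ρ ≤ P.map (toLocalQuot P Q) := by
      intro a ha
      obtain ⟨r, s, hs, hrs⟩ := exists_mul_toLocalQuot_eq P Q a
      obtain ⟨t, ht⟩ := (isUnit_toLocalQuot P Q hs).exists_right_inv
      have hr : r ∈ P := by
        rw [← algebraMap_resField_eq_zero_iff, ← hρ, ← hrs, map_mul, (RingHom.mem_ker).1 ha,
          zero_mul]
      rw [← mul_one a, ← ht, ← mul_assoc, hrs]
      exact Ideal.mul_mem_right _ _ (Ideal.mem_map_of_mem _ hr)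
    rw [Ideal.zero_eq_bot, eq_bot_iff]
    refine (Ideal.pow_right_mono hle N).trans ?_
    rw [← Ideal.map_pow, Ideal.map_le_iff_le_comap]
    intro r hr
    refine Ideal.Quotient.eq_zero_iff_mem.2 (Ideal.mem_map_of_mem _ (hN hr))

/-- If `γ` maps the `P`-primary ideal `Q` into the ideal `I` of finite colength, then `F[[y]]/I` is
a quotient of `R_P / Q R_P`, which in turn is a quotient of `F[[y]]`. -/
theorem exists_surjective_localQuot [CharZero K] (hP : P.height = c)
    (he : ComplementIndependent P e) {Q : Ideal (MvPolynomial (Fin n) K)} (hQP : Q.radical = P)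
    {I : Ideal (MvPowerSeries (Fin c) (ResField P))} {N : ℕ}
    (hI : Ideal.span (Set.range MvPowerSeries.X) ^ N ≤ I)
    (hI' : I ≤ IsLocalRing.maximalIdeal (MvPowerSeries (Fin c) (ResField P)))
    (hQI : ∀ q ∈ Q, gammaHat P e q ∈ I) :
    ∃ (ψ : MvPowerSeries (Fin c) (ResField P) →+* LocalQuot P Q)
      (g : LocalQuot P Q →+* MvPowerSeries (Fin c) (ResField P) ⧸ I),
      Function.Surjective ψ ∧ (∀ r, ψ (gammaHat P e r) = toLocalQuot P Q r) ∧
      (∀ r, g (toLocalQuot P Q r) = Ideal.Quotient.mk I (gammaHat P e r)) ∧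
      ∀ f, g (ψ f) = Ideal.Quotient.mk I f := by
  let T := ↥(Set.range e)ᶜ
  let ren : MvPolynomial T K →ₐ[K] MvPolynomial (Fin n) K := MvPolynomial.rename Subtype.val
  let : Algebra (MvPolynomial T K) (MvPolynomial (Fin n) K) := ren.toRingHom.toAlgebra
  have : IsScalarTower K (MvPolynomial T K) (MvPolynomial (Fin n) K) :=
    IsScalarTower.of_algebraMap_eq fun a => (ren.commutes a).symm
  have htower : ∀ b, algebraMap (MvPolynomial T K) (ResField P) b =
      algebraMap (MvPolynomial (Fin n) K) (ResField P) (ren b) := fun b =>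
    IsScalarTower.algebraMap_apply (MvPolynomial T K) (MvPolynomial (Fin n) K) (ResField P) b
  have hren : ∀ t : T, algebraMap (MvPolynomial T K) (MvPolynomial (Fin n) K) (MvPolynomial.X t) =
      MvPolynomial.X t.1 := fun t => MvPolynomial.rename_X _ _
  have : Algebra.FormallyEtale (MvPolynomial T K) (ResField P) := by
    have hfun : (fun t : T => algebraMap (MvPolynomial T K) (ResField P) (MvPolynomial.X t)) =
        fun t => varClass P t.1 := by
      funext t
      rw [htower]
      exact congrArg _ (hren t)
    refine formallyEtale_of_isTranscendenceBasis ?_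
    rw [hfun]
    exact isTranscendenceBasis_of_complementIndependent P hP he
  have hadj : Algebra.adjoin (MvPolynomial T K)
      (Set.range fun i => (MvPolynomial.X (e i) : MvPolynomial (Fin n) K)) = ⊤ := by
    refine eq_top_iff.2 fun f _ => ?_
    induction f using MvPolynomial.induction_on with
    | C a =>
      have : (MvPolynomial.C a : MvPolynomial (Fin n) K) = algebraMap (MvPolynomial T K) _
          (MvPolynomial.C a) := (MvPolynomial.rename_C _ a).symm
      rw [this]
      exact Subalgebra.algebraMap_mem _ _
    | add p q hp hq => exact Subalgebra.add_mem _ (hp trivial) (hq trivial)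
    | mul_X p j hp =>
      refine Subalgebra.mul_mem _ (hp trivial) ?_
      by_cases hj : j ∈ Set.range e
      · obtain ⟨i, rfl⟩ := hj
        exact Algebra.subset_adjoin ⟨i, rfl⟩
      · rw [← hren ⟨j, hj⟩]
        exact Subalgebra.algebraMap_mem _ _
  obtain ⟨ρ, hρ, hρs, hnil⟩ := exists_residue P hQP
  let g : LocalQuot P Q →+* MvPowerSeries (Fin c) (ResField P) ⧸ I :=
    liftLocalQuot P ((Ideal.Quotient.mk I).comp (gammaHat P e))
      (fun q hq => Ideal.Quotient.eq_zero_iff_mem.2 (hQI q hq))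
      fun s hs => (isUnit_gammaHat P e hs).map (Ideal.Quotient.mk I)
  have hg : ∀ r, g (toLocalQuot P Q r) = Ideal.Quotient.mk I (gammaHat P e r) :=
    liftLocalQuot_apply P _ _ _
  obtain ⟨ψ, h1, h2, h3⟩ := exists_surjective_of_formallyEtale hadj (γ := gammaHat P e)
    (fun b => by
      rw [htower, ← MvPolynomial.coe_C, ← gamma_rename]
      rfl) (fun i => by
      rw [gammaHat_apply, gamma_X_self, MvPolynomial.coe_add, MvPolynomial.coe_C,
        MvPolynomial.coe_X]) hρ hρs hnil
    (fun a => by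
      obtain ⟨r, s, hs, h⟩ := exists_mul_toLocalQuot_eq P Q a
      exact ⟨r, s, isUnit_toLocalQuot P Q hs, h⟩) hI hI' hg
  exact ⟨ψ, g, h1, h2, hg, h3⟩

/-- The length of `R_P / Q R_P` is the same over every ring that surjects onto it. -/
theorem length_eq_multiplicity {Q : Ideal (MvPolynomial (Fin n) K)} {S : Type*}
    [CommRing S] [Algebra S (LocalQuot P Q)]
    (h : Function.Surjective (algebraMap S (LocalQuot P Q))) :
    Module.length S (LocalQuot P Q) = multiplicity P Q := by
  rw [Module.length_eq_of_surjective h]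
  exact (Module.length_eq_of_surjective
    (R := Localization.AtPrime P ⧸
      Q.map (algebraMap (MvPolynomial (Fin n) K) (Localization.AtPrime P)))
    (S := Localization.AtPrime P)
    (M := Localization.AtPrime P ⧸
      Q.map (algebraMap (MvPolynomial (Fin n) K) (Localization.AtPrime P)))
    Ideal.Quotient.mk_surjective).symm

theorem length_quotient_eq_multiplicity {Q : Ideal (MvPolynomial (Fin n) K)} {S : Type*}
    [CommRing S] {I : Ideal S} (ψ : S →+* LocalQuot P Q) (h : Function.Surjective ψ)
    (hI : RingHom.ker ψ = I) :
    Module.length S (S ⧸ I) = multiplicity P Q := by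
  subst hI
  let : Algebra S (LocalQuot P Q) := ψ.toAlgebra
  rw [← length_eq_multiplicity P (S := S) h]
  exact (Ideal.quotientKerAlgEquivOfSurjective (f := Algebra.ofId S (LocalQuot P Q))
    h).toLinearEquiv.length_eq

/-- The kernel of the surjection `F[[y]] → R_P / Q R_P` contains `⟨y⟩^m`, because the target has
length `m`, and it contains `γ(Q)`; conversely `F[[y]]/(⟨y⟩^m + ⟨γ(Q)⟩)` is a quotient of
`R_P / Q R_P`. So `F[[y]]/(⟨y⟩^m + ⟨γ(Q)⟩)` is isomorphic to `R_P / Q R_P`. -/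
theorem toHilb_mem_and_comap_eq [CharZero K] (hP : P.height = c)
    (he : ComplementIndependent P e) {m : ℕ} (hm : 1 ≤ m) {Q : Ideal (MvPolynomial (Fin n) K)}
    (hQ : Q ∈ primaryIdeals P m) :
    toHilb P e m Q ∈ hilbPoints (ResField P) c m ∧ (toHilb P e m Q).comap (gammaHat P e) = Q := by
  obtain ⟨hprim, hrad, hmult⟩ := hQ
  have h1 : Ideal.span (Set.range MvPowerSeries.X) ^ m ≤ toHilb P e m Q := le_sup_left
  have h2 : ∀ q ∈ Q, gammaHat P e q ∈ toHilb P e m Q := fun q hq =>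
    (le_sup_right : Q.map (gammaHat P e) ≤ _) (Ideal.mem_map_of_mem _ hq)
  have h3 : toHilb P e m Q ≤ IsLocalRing.maximalIdeal (MvPowerSeries (Fin c) (ResField P)) := by
    refine sup_le ?_ (Ideal.map_le_iff_le_comap.2 fun q hq => ?_)
    · rw [span_X_eq_maximalIdeal]
      exact Ideal.pow_le_self (by omega)
    · exact (gammaHat_mem_maximalIdeal_iff P e q).2 (hrad ▸ Ideal.le_radical hq)
  obtain ⟨ψ, g, hψ, hψγ, -, hgψ⟩ := exists_surjective_localQuot P e hP he hrad h1 h3 h2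
  have hker : RingHom.ker ψ = toHilb P e m Q := by
    refine le_antisymm (fun f hf => ?_) (sup_le ?_ (Ideal.map_le_iff_le_comap.2 fun q hq => ?_))
    · rw [← Ideal.Quotient.eq_zero_iff_mem, ← hgψ, (RingHom.mem_ker).1 hf, map_zero]
    · let : Algebra (MvPowerSeries (Fin c) (ResField P)) (LocalQuot P Q) := ψ.toAlgebra
      have hl := length_eq_multiplicity P (S := MvPowerSeries (Fin c) (ResField P)) (Q := Q) hψ
      rw [hmult] at hl
      rw [span_X_eq_maximalIdeal]
      intro f hf
      have := maximalIdeal_pow_smul_eq_zero (Module.length_ne_top_iff.1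
        (by rw [hl]; exact ENat.natCast_ne_top m)) hl.le f hf (1 : LocalQuot P Q)
      rwa [Algebra.smul_def, mul_one] at this
    · rw [Ideal.mem_comap, RingHom.mem_ker, hψγ, toLocalQuot_eq_zero_iff P hprim hrad]
      exact hq
  constructor
  · refine (finrank_eq_iff_length_eq (residue_surjective (c := c)) hm).2 ?_
    rw [length_quotient_eq_multiplicity P ψ hψ hker, hmult]
  · ext r
    rw [Ideal.mem_comap, ← hker, RingHom.mem_ker, hψγ, toLocalQuot_eq_zero_iff P hprim hrad]

/-- For `Q = γ⁻¹(I)` the induced map `R_P / Q R_P → F[[y]]/I` is injective by the choice of `Q`,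
and it is surjective since `F[[y]] → F[[y]]/I` factors through it. -/
theorem comap_mem_primaryIdeals [CharZero K] (hP : P.height = c)
    (he : ComplementIndependent P e) {m : ℕ} (hm : 1 ≤ m)
    {I : Ideal (MvPowerSeries (Fin c) (ResField P))} (hI : I ∈ hilbPoints (ResField P) c m) :
    I.comap (gammaHat P e) ∈ primaryIdeals P m := by
  have h1 := span_X_pow_le_of_finrank hm hI
  have hlen := (finrank_eq_iff_length_eq (residue_surjective (c := c)) hm).1 hI
  have h3 : I ≤ IsLocalRing.maximalIdeal (MvPowerSeries (Fin c) (ResField P)) := by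
    refine IsLocalRing.le_maximalIdeal fun htop => ?_
    rw [Module.length_eq_zero_iff.2 (Ideal.Quotient.subsingleton_iff.2 htop)] at hlen
    have : m = 0 := by exact_mod_cast hlen.symm
    omega
  have hrad : I.radical = IsLocalRing.maximalIdeal (MvPowerSeries (Fin c) (ResField P)) := by
    refine le_antisymm ?_ fun f hf => ⟨m, h1 ?_⟩
    · exact (Ideal.radical_mono h3).trans
        (Ideal.IsPrime.radical (IsLocalRing.maximalIdeal.isMaximal _).isPrime).le
    · rw [span_X_eq_maximalIdeal]
      exact Ideal.pow_mem_pow hf m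
  have hprim : (I.comap (gammaHat P e)).IsPrimary := by
    refine Ideal.IsPrimary.comap (Ideal.isPrimary_of_isMaximal_radical ?_) _
    rw [hrad]
    exact IsLocalRing.maximalIdeal.isMaximal _
  have hradP : (I.comap (gammaHat P e)).radical = P := by
    rw [← Ideal.comap_radical, hrad]
    ext f
    exact gammaHat_mem_maximalIdeal_iff P e f
  obtain ⟨ψ, g, hψ, hψγ, hg, hgψ⟩ :=
    exists_surjective_localQuot P e hP he hradP h1 h3 fun q hq => hq
  have hginj : ∀ a, g a = 0 → a = 0 := by
    intro a ha
    obtain ⟨r, s, hs, hrs⟩ := exists_mul_toLocalQuot_eq P _ a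
    have hr : g (toLocalQuot P _ r) = 0 := by rw [← hrs, map_mul, ha, zero_mul]
    rw [hg, Ideal.Quotient.eq_zero_iff_mem] at hr
    rw [(toLocalQuot_eq_zero_iff P hprim hradP r).2 hr] at hrs
    exact (isUnit_toLocalQuot P _ hs).mul_left_eq_zero.1 hrs
  have hker : RingHom.ker ψ = I := by
    ext f
    rw [RingHom.mem_ker, ← Ideal.Quotient.eq_zero_iff_mem (I := I), ← hgψ]
    exact ⟨fun h => by rw [h, map_zero], hginj _⟩
  exact ⟨hprim, hradP, (length_quotient_eq_multiplicity P ψ hψ hker).symm.trans hlen⟩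

/-- Nested ideals of the same finite colength are equal. -/
theorem eq_of_le_of_mem_hilbPoints {F : Type*} [Field F] {m : ℕ} (hm : 1 ≤ m)
    {I J : Ideal (MvPowerSeries (Fin c) F)} (hI : I ∈ hilbPoints F c m)
    (hJ : J ∈ hilbPoints F c m) (h : I ≤ J) : I = J := by
  have : FiniteDimensional F (MvPowerSeries (Fin c) F ⧸ I) :=
    Module.finite_of_finrank_pos (by rw [hI]; omega)
  have : FiniteDimensional F (MvPowerSeries (Fin c) F ⧸ J) :=
    Module.finite_of_finrank_pos (by rw [hJ]; omega)
  let π := (Ideal.Quotient.factorₐ F h).toLinearMap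
  have hπ : Function.Injective π := (LinearMap.injective_iff_surjective_of_finrank_eq_finrank
    (hI.trans hJ.symm)).2 (Ideal.Quotient.factor_surjective h)
  refine le_antisymm h fun f hf => ?_
  rw [← Ideal.Quotient.eq_zero_iff_mem] at hf ⊢
  exact hπ (hf.trans (map_zero π).symm)

/-- The correspondence between `P`-primary ideals of multiplicity `m` and ideals of `F[[y]]` of
colength `m`. -/
theorem hilb_correspondence [CharZero K] (hP : P.height = c)
    (he : ComplementIndependent P e) {m : ℕ} (hm : 1 ≤ m) :
    Set.BijOn (toHilb P e m) (primaryIdeals P m) (hilbPoints (ResField P) c m) ∧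
      Set.InvOn (Ideal.comap (gammaHat P e)) (toHilb P e m) (primaryIdeals P m)
        (hilbPoints (ResField P) c m) := by
  have hinv : Set.InvOn (Ideal.comap (gammaHat P e)) (toHilb P e m) (primaryIdeals P m)
      (hilbPoints (ResField P) c m) := by
    refine ⟨fun Q hQ => (toHilb_mem_and_comap_eq P e hP he hm hQ).2, fun I hI => ?_⟩
    have hQ := comap_mem_primaryIdeals P e hP he hm hI
    refine eq_of_le_of_mem_hilbPoints hm (toHilb_mem_and_comap_eq P e hP he hm hQ).1 hI
      (sup_le (span_X_pow_le_of_finrank hm hI) Ideal.map_comap_le)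
  exact ⟨hinv.bijOn (fun Q hQ => (toHilb_mem_and_comap_eq P e hP he hm hQ).1)
    fun I hI => comap_mem_primaryIdeals P e hP he hm hI, hinv⟩

end Primary

end PrimaryIdeals

end

theorem theorem2p1 {K : Type*} [Field K] [CharZero K] {n c : ℕ}
    (P : Ideal (MvPolynomial (Fin n) K)) [P.IsPrime] (hP : P.height = c) :
    (∃ e : Fin c ↪ Fin n, PrimaryIdeals.ComplementIndependent P e) ∧
    ∀ e : Fin c ↪ Fin n, PrimaryIdeals.ComplementIndependent P e → ∀ m : ℕ, 1 ≤ m →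
      -- (a) and (b)
      (Set.BijOn (PrimaryIdeals.toHilb P e m) (PrimaryIdeals.primaryIdeals P m)
          (PrimaryIdeals.hilbPoints (PrimaryIdeals.ResField P) c m) ∧
        Set.InvOn (Ideal.comap (PrimaryIdeals.gammaHat P e)) (PrimaryIdeals.toHilb P e m)
          (PrimaryIdeals.primaryIdeals P m)
          (PrimaryIdeals.hilbPoints (PrimaryIdeals.ResField P) c m)) ∧
      -- (b) and (c)
      (Set.BijOn PrimaryIdeals.inverseSystem
          (PrimaryIdeals.hilbPoints (PrimaryIdeals.ResField P) c m)
          (PrimaryIdeals.diffClosedSubspaces (PrimaryIdeals.ResField P) c m) ∧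
        Set.InvOn PrimaryIdeals.annihilator PrimaryIdeals.inverseSystem
          (PrimaryIdeals.hilbPoints (PrimaryIdeals.ResField P) c m)
          (PrimaryIdeals.diffClosedSubspaces (PrimaryIdeals.ResField P) c m)) ∧
      -- (c) and (d)
      (Set.BijOn (Submodule.map (PrimaryIdeals.omega P e))
          (PrimaryIdeals.diffClosedSubspaces (PrimaryIdeals.ResField P) c m)
          (PrimaryIdeals.subBimodules P e m) ∧
        Set.InvOn (Submodule.comap (PrimaryIdeals.omega P e))
          (Submodule.map (PrimaryIdeals.omega P e))
          (PrimaryIdeals.diffClosedSubspaces (PrimaryIdeals.ResField P) c m)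
          (PrimaryIdeals.subBimodules P e m)) ∧
      -- lifting bases in (d) to Noetherian operators
      ∀ Q ∈ PrimaryIdeals.primaryIdeals P m,
        ∀ b : Module.Basis (Fin m) (PrimaryIdeals.ResField P)
          ((PrimaryIdeals.inverseSystem (PrimaryIdeals.toHilb P e m Q)).map
            (PrimaryIdeals.omega P e)),
          (∃ A : Fin m → PrimaryIdeals.RelWeyl K e,
            PrimaryIdeals.IsLift P e (fun l => (b l : PrimaryIdeals.WeylNoether P e)) A) ∧
          ∀ A : Fin m → PrimaryIdeals.RelWeyl K e,
            PrimaryIdeals.IsLift P e (fun l => (b l : PrimaryIdeals.WeylNoether P e)) A →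
              PrimaryIdeals.Represents P e A Q := by
  refine ⟨PrimaryIdeals.exists_complementIndependent P hP, fun e he m hm =>
    ⟨PrimaryIdeals.hilb_correspondence P e hP he hm, PrimaryIdeals.macaulay_correspondence hm,
      PrimaryIdeals.weylNoether_correspondence P e m, fun Q hQ b => ⟨?_, fun A hA => ?_⟩⟩⟩
  · choose A s hs h using fun l =>
      PrimaryIdeals.exists_lift_weylNoether P e (b l : PrimaryIdeals.WeylNoether P e)
    exact ⟨A, fun l => ⟨s l, hs l, h l⟩⟩
  · have h := PrimaryIdeals.toHilb_mem_and_comap_eq P e hP he hm hQ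
    have h2 := PrimaryIdeals.represents_of_isLift P e
      (PrimaryIdeals.span_X_pow_le_of_finrank hm h.1) b hA
    rwa [h.2] at h2
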